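/- Throughout, $n\ge 0$, $I_n=\{1<\dots<n\}$ and $C(n,k)$ is the set of $k$-element subsets of $I_n$. **Realizable sets.** The $k$-packet of $X\in C(n,k+1)$ is the set $P_X$ of all $k$-element subsets of $X$, ordered lexicographically. For $J\subseteq C(n,k)$ let $J_p$, $J_s$, $J_F$, $J_\emptyset$ be the sets of those $X\in C(n,k+1)$ for which $P_X\cap J$ is, respectively, a nonempty proper prefix (initial segment) of $P_X$, a nonempty proper suffix (final segment) of $P_X$, all of $P_X$, empty. $J$ is a *realizable $k$-set* if $J_p\cup J_s\cup J_F\cup J_\emptyset=C(n,k+1)$. **The sets $L^i$, $M^i$.** For a realizable $2$-set $J$ put $L^2=\emptyset$, $M^2=J$ and, for $i\ge 3$, $$L^i=(M^{i-1})_s,\qquad M^i=(M^{i-1})_s\cup(M^{i-1}\setminus L^{i-1})_F .$$ **Admissible orders.** Let $J\subseteq C(n,k)$. A total order $\rho$ on $J$ is *admissible* if it induces on $P_X\cap J$ the antilexicographic order for every $X\in J_s$, the lexicographic order for every $X\in J_p$, and one of these two orders for every $X\in J_F$. Its *inversion set* is $\mathrm{Inv}(\rho)=\{X\in J_F:\rho|_{P_X}\text{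 is antilexicographic}\}\cup J_s$. Two admissible orders on $J$ are *elementary equivalent* if they differ by interchanging two neighbouring elements that lie in no common $k$-packet; $\sim$ is the generated equivalence relation, and $\mathrm{Inv}$ is well defined on $\sim$-classes. If $X\in J_F$ and $P_X$ is a contiguous block of $\rho$, the *packet flip* $p_X(\rho)$ is obtained by reversing this block. The classes are partially ordered by the Manin–Schechtman order: $r\le_{MS}r'$ if $r'$ is obtained from $r$ by a finite (possibly empty) sequence of steps $[\rho]\mapsto[p_X(\rho)]$ with $X\notin\mathrm{Inv}(\rho)$. **Bruhat orders of $J$.** For a realizable $2$-set $J$ and $i\ge 2$, the *$i$-th Bruhat order* $B_i(J)$ is the set of $\sim$-classes of those admissible orders on $M^i$ that place the elements of $L^i$ first, partially ordered as a subposet of the poset of all $\sim$-classes of admissible orders on $M^i$. **Theorem.** Let $J$ be a realizable $2$-set. 1. Let $i\ge 2$ and let $K$ be a realizable $i$-set with $L^i\subseteq K\subseteq M^i$. Then $K_s\cup (M^i)_s$ is a realizable $(i+1)$-set. 2. Let $i\ge 3$. There is exactly one element $r\in B_{i-1}(J)$ with $\mathrm{Inv}(r)=M^i$. It satisfies $r'\le_{MS}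 r$ for every $r'\in B_{i-1}(J)$, and it is the unique maximal element of $B_{i-1}(J)$. -/

import Mathlib

namespace HigherBruhat

/-- A family of subsets of an `n`-element linearly ordered ground set. -/
abbrev Family (n : ℕ) := Finset (Finset (Fin n))

/-- `C(n,k)`: all `k`-element subsets of the ground set. -/
def C (n k : ℕ) : Family n := Finset.powersetCard k Finset.univ

/-- The `k`-packet `P_X` of a `(k+1)`-set `X`: all `k`-element subsets of `X`. -/
def packet {n : ℕ} (k : ℕ) (X : Finset (Fin n)) : Family n := Finset.powersetCard k X

/-- Strict lexicographic order on sets of equal size (listed increasingly): at the first place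
where the sets differ, `A` has the smaller entry, i.e. the least element of the symmetric
difference belongs to `A`. -/
def LexLT {n : ℕ} (A B : Finset (Fin n)) : Prop :=
  ∃ a, a ∈ A ∧ a ∉ B ∧ ∀ b, b < a → (b ∈ A ↔ b ∈ B)

/-- `P_X ∩ J` is a (nonempty) proper prefix of `P_X` in lexicographic order. -/
def IsPrefixAt {n : ℕ} (k : ℕ) (J : Family n) (X : Finset (Fin n)) : Prop :=
  (packet k X ∩ J).Nonempty ∧ packet k X ∩ J ≠ packet k X ∧
    ∀ A ∈ packet k X, ∀ B ∈ packet k X, LexLT A B → B ∈ J → A ∈ J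

/-- `P_X ∩ J` is a (nonempty) proper suffix of `P_X` in lexicographic order. -/
def IsSuffixAt {n : ℕ} (k : ℕ) (J : Family n) (X : Finset (Fin n)) : Prop :=
  (packet k X ∩ J).Nonempty ∧ packet k X ∩ J ≠ packet k X ∧
    ∀ A ∈ packet k X, ∀ B ∈ packet k X, LexLT A B → A ∈ J → B ∈ J

open Classical in
/-- `J_p`, for a family `J` of `k`-sets: the `(k+1)`-sets whose packet meets `J` in a proper
prefix. -/
noncomputable def pre {n : ℕ} (k : ℕ) (J : Family n) : Family n :=
  (C n (k + 1)).filter fun X => IsPrefixAt k J X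

open Classical in
/-- `J_s`, for a family `J` of `k`-sets: the `(k+1)`-sets whose packet meets `J` in a proper
suffix. -/
noncomputable def suf {n : ℕ} (k : ℕ) (J : Family n) : Family n :=
  (C n (k + 1)).filter fun X => IsSuffixAt k J X

/-- `J_F`, for a family `J` of `k`-sets. -/
def full {n : ℕ} (k : ℕ) (J : Family n) : Family n :=
  (C n (k + 1)).filter fun X => packet k X ∩ J = packet k X

/-- `J_∅`, for a family `J` of `k`-sets. -/
def empt {n : ℕ} (k : ℕ) (J : Family n) : Family n :=
  (C n (k + 1)).filter fun X => packet k X ∩ J = ∅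

/-- `J` is a realizable `k`-set: a set of `k`-subsets meeting every `k`-packet in a (possibly
empty, possibly full) prefix or suffix. -/
def Realizable {n : ℕ} (k : ℕ) (J : Family n) : Prop :=
  J ⊆ C n k ∧ suf k J ∪ pre k J ∪ full k J ∪ empt k J = C n (k + 1)

/-- The pair `(L^i, M^i)`, defined recursively from `(L^2, M^2) = (∅, J)`.
(The values at `i = 0, 1` are unused.) -/
noncomputable def LM {n : ℕ} (J : Family n) : ℕ → Family n × Family n
  | 0 => (∅, ∅)
  | 1 => (∅, ∅)
  | 2 => (∅, J)
  | i + 3 =>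
    (suf (i + 2) (LM J (i + 2)).2,
      suf (i + 2) (LM J (i + 2)).2 ∪ full (i + 2) ((LM J (i + 2)).2 \ (LM J (i + 2)).1))

/-- `L^i`. -/
noncomputable def L {n : ℕ} (J : Family n) (i : ℕ) : Family n := (LM J i).1

/-- `M^i`. -/
noncomputable def M {n : ℕ} (J : Family n) (i : ℕ) : Family n := (LM J i).2

/-- The total order given by the list `l` is lexicographic on `P_X`, as far as it is listed. -/
def InducesLex {n : ℕ} (k : ℕ) (l : List (Finset (Fin n))) (X : Finset (Fin n)) : Prop :=
  (l.filter fun A => A ∈ packet k X).Pairwise fun A B => LexLT A B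

/-- The total order given by the list `l` is antilexicographic on `P_X`, as far as it is
listed. -/
def InducesAnti {n : ℕ} (k : ℕ) (l : List (Finset (Fin n))) (X : Finset (Fin n)) : Prop :=
  (l.filter fun A => A ∈ packet k X).Pairwise fun A B => LexLT B A

/-- Admissible orders on a family `J` of `k`-sets. A total order on `J` is written as the list
of the elements of `J` in increasing order. -/
structure AdmOrder {n : ℕ} (k : ℕ) (J : Family n) where
  list : List (Finset (Fin n))
  nodup : list.Nodup
  toFinset_eq : list.toFinset = J
  anti_of_suf : ∀ X ∈ suf k J, InducesAnti k list X
  lex_of_pre : ∀ X ∈ pre k J, InducesLex k list X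
  lex_or_anti_of_full : ∀ X ∈ full k J, InducesLex k list X ∨ InducesAnti k list X

namespace AdmOrder

variable {n k : ℕ} {J : Family n}

open Classical in
/-- The inversion set `{X ∈ J_F | ρ is antilexicographic on P_X} ∪ J_s`. -/
noncomputable def inv (ρ : AdmOrder k J) : Family n :=
  ((full k J).filter fun X => InducesAnti k ρ.list X) ∪ suf k J

theorem mem_inv {ρ : AdmOrder k J} {X : Finset (Fin n)} :
    X ∈ ρ.inv ↔ (X ∈ full k J ∧ InducesAnti k ρ.list X) ∨ X ∈ suf k J := by
  classical
  unfold inv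
  rw [Finset.mem_union, Finset.mem_filter]

/-- Elementary equivalence: interchange of two neighbouring elements that do not lie in a common
`k`-packet. -/
def ElemEquiv (ρ σ : AdmOrder k J) : Prop :=
  ∃ (u v : List (Finset (Fin n))) (A B : Finset (Fin n)),
    (¬ ∃ X ∈ C n (k + 1), A ∈ packet k X ∧ B ∈ packet k X) ∧
      ρ.list = u ++ A :: B :: v ∧ σ.list = u ++ B :: A :: v

/-- `X ∈ J_F`, the packet `P_X` is a contiguous block of `ρ`, and `σ = p_X(ρ)` arises from `ρ` by
reversing that block. -/
def IsFlip (X : Finset (Fin n)) (ρ σ : AdmOrder k J) : Prop :=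
  X ∈ full k J ∧ ∃ u c v : List (Finset (Fin n)),
    c.toFinset = packet k X ∧ ρ.list = u ++ c ++ v ∧ σ.list = u ++ c.reverse ++ v

/-- The order `ρ` places the elements of `S` first: `S` is a prefix of `ρ`. -/
def PlacesFirst (S : Family n) (ρ : AdmOrder k J) : Prop :=
  ∃ u v : List (Finset (Fin n)), ρ.list = u ++ v ∧ u.toFinset = S

/-- The equivalence relation generated by elementary equivalences. -/
def setoid (k : ℕ) (J : Family n) : Setoid (AdmOrder k J) := Relation.EqvGen.setoid ElemEquiv

theorem inv_eq_of_elemEquiv {ρ σ : AdmOrder k J} (h : ElemEquiv ρ σ) : ρ.inv = σ.inv := by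
  obtain ⟨u, v, A, B, hAB, h1, h2⟩ := h
  ext X
  rw [mem_inv, mem_inv]
  refine or_congr_left (and_congr_right fun hX => ?_)
  have hXC : X ∈ C n (k + 1) := (Finset.mem_filter.1 hX).1
  have hl : (ρ.list.filter fun A => A ∈ packet k X) = σ.list.filter fun A => A ∈ packet k X := by
    rw [h1, h2]
    by_cases hA : A ∈ packet k X
    · have hB : B ∉ packet k X := fun hB => hAB ⟨X, hXC, hA, hB⟩
      simp [List.filter_cons, hA, hB]
    · simp [List.filter_cons, hA]
  unfold InducesAnti
  rw [hl]

theorem inv_eq_of_eqvGen {ρ σ : AdmOrder k J} (h : Relation.EqvGen ElemEquiv ρ σ) :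
    ρ.inv = σ.inv := by
  induction h with
  | rel _ _ h => exact inv_eq_of_elemEquiv h
  | refl _ => rfl
  | symm _ _ _ ih => exact ih.symm
  | trans _ _ _ _ _ ih1 ih2 => exact ih1.trans ih2

end AdmOrder

/-- Admissible orders on `J` (equivalently, paths from `∅` to `J`) up to elementary
equivalences. -/
def Classes {n : ℕ} (k : ℕ) (J : Family n) : Type := Quotient (AdmOrder.setoid k J)

namespace Classes

variable {n k : ℕ} {J : Family n}

/-- The class of an admissible order. -/
def mk (ρ : AdmOrder k J) : Classes k J := Quotient.mk _ ρ

/-- The inversion set of a class. -/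
noncomputable def inv (r : Classes k J) : Family n :=
  Quotient.lift (s := AdmOrder.setoid k J) AdmOrder.inv
    (fun _ _ h => AdmOrder.inv_eq_of_eqvGen h) r

/-- `s = p_X(r)` for some `X ∈ N(r) \ Inv(r)`. -/
def FlipUp (r s : Classes k J) : Prop :=
  ∃ (X : Finset (Fin n)) (ρ σ : AdmOrder k J),
    mk ρ = r ∧ mk σ = s ∧ X ∉ r.inv ∧ AdmOrder.IsFlip X ρ σ

theorem packet_inter {n k : ℕ} {X Y A B : Finset (Fin n)} (hX : X ∈ C n (k + 1))
    (hY : Y ∈ C n (k + 1)) (hXY : X ≠ Y) (hAX : A ∈ packet k X) (hAY : A ∈ packet k Y)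
    (hBX : B ∈ packet k X) (hBY : B ∈ packet k Y) : A = B := by
  simp only [C, packet, Finset.mem_powersetCard] at *
  have hlt : (X ∩ Y).card < k + 1 := by
    by_contra hc
    have h1 : X ∩ Y = X := Finset.eq_of_subset_of_card_le Finset.inter_subset_left (by omega)
    have h2 : X ∩ Y = Y := Finset.eq_of_subset_of_card_le Finset.inter_subset_right (by omega)
    exact hXY (h1.symm.trans h2)
  have hA := Finset.eq_of_subset_of_card_le (Finset.subset_inter hAX.1 hAY.1) (by omega)
  have hB := Finset.eq_of_subset_of_card_le (Finset.subset_inter hBX.1 hBY.1) (by omega)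
  exact hA.trans hB.symm

theorem inv_ssubset_of_flipUp {r s : Classes k J} (h : FlipUp r s) : r.inv ⊂ s.inv := by
  obtain ⟨X, ρ, σ, rfl, rfl, hX, hXF, u, c, v, hc, hρ, hσ⟩ := h
  have hXC : X ∈ C n (k + 1) := (Finset.mem_filter.1 hXF).1
  change X ∉ ρ.inv at hX
  change ρ.inv ⊂ σ.inv
  have hnd := ρ.nodup
  rw [hρ] at hnd
  have hother : ∀ Y ∈ C n (k + 1), Y ≠ X →
      (ρ.list.filter fun A => A ∈ packet k Y) = σ.list.filter fun A => A ∈ packet k Y := by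
    intro Y hY hne
    have hlen : (c.filter fun A => A ∈ packet k Y).length ≤ 1 := by
      have hcn : (c.filter fun A => A ∈ packet k Y).Nodup :=
        ((List.nodup_append.1 (List.nodup_append.1 hnd).1).2.1).filter _
      rw [← List.toFinset_card_of_nodup hcn, Finset.card_le_one]
      intro A hA B hB
      simp only [List.mem_toFinset, List.mem_filter, decide_eq_true_eq] at hA hB
      have hA' : A ∈ packet k X := by rw [← hc]; simpa using hA.1
      have hB' : B ∈ packet k X := by rw [← hc]; simpa using hB.1
      exact packet_inter hXC hY hne.symm hA' hA.2 hB' hB.2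
    have hrev : (c.filter fun A => A ∈ packet k Y).reverse
        = c.filter fun A => A ∈ packet k Y := by
      match c.filter fun A => A ∈ packet k Y, hlen with
      | [], _ => rfl
      | [_], _ => rfl
    rw [hρ, hσ]
    simp only [List.filter_append, List.filter_reverse, hrev]
  have hXs : X ∉ suf k J := fun h => hX (AdmOrder.mem_inv.2 (Or.inr h))
  have hlexX : InducesLex k ρ.list X := by
    rcases ρ.lex_or_anti_of_full X hXF with h | h
    · exact h
    · exact absurd (AdmOrder.mem_inv.2 (Or.inl ⟨hXF, h⟩)) hX
  have hdis : ∀ w : List (Finset (Fin n)), (∀ A ∈ w, A ∉ c) →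
      (w.filter fun A => A ∈ packet k X) = [] := by
    intro w hw
    rw [List.filter_eq_nil_iff]
    intro A hA
    have := hw A hA
    rw [← hc]
    simpa using this
  have hu : (u.filter fun A => A ∈ packet k X) = [] := hdis u fun A hA hAc =>
    (List.nodup_append.1 (List.nodup_append.1 hnd).1).2.2 A hA A hAc rfl
  have hv : (v.filter fun A => A ∈ packet k X) = [] := hdis v fun A hA hAc =>
    (List.nodup_append.1 hnd).2.2 A (List.mem_append_right _ hAc) A hA rfl
  have hantiX : InducesAnti k σ.list X := by
    unfold InducesLex at hlexX
    unfold InducesAnti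
    rw [hρ] at hlexX
    rw [hσ]
    simp only [List.filter_append, List.filter_reverse, hu, hv, List.nil_append,
      List.append_nil] at hlexX ⊢
    exact List.pairwise_reverse.2 hlexX
  have hXσ : X ∈ σ.inv := AdmOrder.mem_inv.2 (Or.inl ⟨hXF, hantiX⟩)
  refine Finset.ssubset_iff_subset_ne.2 ⟨fun Y hY => ?_, fun h => hX (h ▸ hXσ)⟩
  by_cases hYX : Y = X
  · rwa [hYX]
  rcases AdmOrder.mem_inv.1 hY with ⟨hYF, hYa⟩ | hY
  · refine AdmOrder.mem_inv.2 (Or.inl ⟨hYF, ?_⟩)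
    unfold InducesAnti at hYa ⊢
    rwa [← hother Y (Finset.mem_filter.1 hYF).1 hYX]
  · exact AdmOrder.mem_inv.2 (Or.inr hY)

theorem inv_subset_of_reflTransGen {r s : Classes k J} (h : Relation.ReflTransGen FlipUp r s) :
    r = s ∨ r.inv ⊂ s.inv := by
  induction h with
  | refl => exact Or.inl rfl
  | tail _ hst ih =>
    rcases ih with rfl | ih
    · exact Or.inr (inv_ssubset_of_flipUp hst)
    · exact Or.inr (ih.trans (inv_ssubset_of_flipUp hst))

/-- The Manin-Schechtman order: `r ≤ s` if `s` is obtained from `r` by a finite (possibly empty)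
sequence of packet flips, each of which enlarges the inversion set. -/
instance : PartialOrder (Classes k J) where
  le := Relation.ReflTransGen FlipUp
  le_refl _ := Relation.ReflTransGen.refl
  le_trans _ _ _ := Relation.ReflTransGen.trans
  le_antisymm r s h1 h2 := by
    rcases inv_subset_of_reflTransGen h1 with h | h
    · exact h
    · rcases inv_subset_of_reflTransGen h2 with h' | h'
      · exact h'.symm
      · exact absurd (h.trans h') (ssubset_irrefl _)

end Classes

/-- The `i`-th Bruhat order `B_i(J)` of a realizable `2`-set `J`: classes of admissible orders on
`M^i` which place `L^i` first, as a subposet of the poset of all classes. -/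
def BruhatOrder {n : ℕ} (J : Family n) (i : ℕ) : Set (Classes i (M J i)) :=
  {r | ∃ ρ : AdmOrder i (M J i), ρ.PlacesFirst (L J i) ∧ Classes.mk ρ = r}

end HigherBruhat

/-! A realizable 2-set is the inversion set of a permutation of the ground set (`consistent_triple`,
`Prec`). Call `X` a clique if all its pairs lie in `J`, that is, if the permutation reverses `X`,
and let the top clique of `X` be its longest final segment that is a clique. The recursion for
$L^i$, $M^i$ then has a closed form (`mem_LM_iff`): an $i$-set lies in $L^i$ iff it is not a clique
and its top clique has even size, and in $M^i$ iff it is a clique or its top clique has even size.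

The packet of a clique consists of cliques. In a non-clique `Y` let $m$ be the least element of the
top clique and $q$ its left neighbour. Deleting an element beyond $m$ shrinks the top clique by one;
deleting one before $q$ leaves it unchanged. So, apart from the two twins $Y\setminus q$ and
$Y\setminus m$, the faces on one side of the pivot all lie in $L$ and those on the other side all
lie outside $M$; the parity of the top clique decides which side is which. Hence a family between
$L$ and $M$ meets the packet of `Y` in a prefix or suffix exactly when it satisfies one implication
between the twins (`Pivot.lower_or_upper`, `Pivot.twin_of_lower_or_upper`). This reduces most
consistency questions to one check per non-clique.

For the first claim, passing from a consistent family to its suffix packets preserves consistency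
(`Consistent.suf`), which settles cliques; for non-cliques the twin implication is inherited
(`suf_twin`).

For the second claim, the inversion sets of $B_k(J)$ are exactly the consistent families of
$(k+1)$-sets between $L^{k+1}$ and $M^{k+1}$ (`bruhatInversionSet_inv`,
`exists_admOrder_of_bruhatInversionSet`), and a class is determined by its inversion set
(`Classes.eq_of_inv_eq`). Orders come from the fact that every consistent family is the inversion
set of a ranking of all $k$-sets (`Consistent.exists_ranks`). Since $M^{k+1}$ is itself such a
family, it is attained once. Any smaller such family can be enlarged by a single clique without
losing consistency (`exists_consistent_insert`), and this enlargement is realized by a packet flip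
(`exists_flip`). Climbing in this way ends at $M^{k+1}$, so its class is the greatest element and
therefore the only maximal one. -/

namespace HigherBruhat

/-! ### Packets indexed by the deleted element: deleting a larger element gives a lexicographically
earlier face. -/

section Packets

variable {n k : ℕ} {X A : Finset (Fin n)} {K : Family n}

/-- `K` meets the packet of `X` in an initial segment. -/
def Lower (X : Finset (Fin n)) (K : Family n) : Prop :=
  ∀ a ∈ X, ∀ b ∈ X, b < a → X.erase b ∈ K → X.erase a ∈ K

/-- `K` meets the packet of `X` in a final segment. -/
def Upper (X : Finset (Fin n)) (K : Family n) : Prop :=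
  ∀ a ∈ X, ∀ b ∈ X, b < a → X.erase a ∈ K → X.erase b ∈ K

/-- `K` meets every `k`-packet in an initial or a final segment. -/
def Consistent (k : ℕ) (K : Family n) : Prop :=
  ∀ X : Finset (Fin n), X.card = k + 1 → Lower X K ∨ Upper X K

theorem mem_C : A ∈ C n k ↔ A.card = k := by
  simp [C, Finset.mem_powersetCard]

theorem mem_packet (hX : X.card = k + 1) : A ∈ packet k X ↔ ∃ a ∈ X, X.erase a = A := by
  rw [packet, Finset.mem_powersetCard]
  constructor
  · rintro ⟨h1, h2⟩
    have h3 : (X \ A).card = 1 := by rw [Finset.card_sdiff_of_subset h1]; omega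
    obtain ⟨a, ha⟩ := Finset.card_eq_one.1 h3
    have haX : a ∈ X \ A := by rw [ha]; simp
    refine ⟨a, (Finset.mem_sdiff.1 haX).1, ?_⟩
    rw [Finset.erase_eq, ← ha, Finset.sdiff_sdiff_eq_self h1]
  · rintro ⟨a, ha, rfl⟩
    exact ⟨Finset.erase_subset _ _, by rw [Finset.card_erase_of_mem ha]; omega⟩

theorem erase_mem_packet (hX : X.card = k + 1) {a : Fin n} (ha : a ∈ X) :
    X.erase a ∈ packet k X :=
  (mem_packet hX).2 ⟨a, ha, rfl⟩

theorem lexLT_erase {a b : Fin n} (ha : a ∈ X) (hb : b ∈ X) :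
    LexLT (X.erase a) (X.erase b) ↔ b < a := by
  constructor
  · rintro ⟨c, hc1, hc2, hc3⟩
    have hcb : c = b := by
      by_contra h
      exact hc2 (Finset.mem_erase.2 ⟨h, (Finset.mem_erase.1 hc1).2⟩)
    subst hcb
    by_contra h
    have hne : a ≠ c := fun h => (Finset.mem_erase.1 hc1).1 h.symm
    have hlt : a < c := lt_of_le_of_ne (not_lt.1 h) hne
    have := (hc3 a hlt).2 (Finset.mem_erase.2 ⟨hne, ha⟩)
    exact (Finset.mem_erase.1 this).1 rfl
  · intro h
    refine ⟨b, Finset.mem_erase.2 ⟨h.ne, hb⟩, fun h' => (Finset.mem_erase.1 h').1 rfl, ?_⟩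
    intro c hc
    simp [Finset.mem_erase, hc.ne, (hc.trans h).ne]

theorem packet_inter_eq_iff (hX : X.card = k + 1) :
    packet k X ∩ K = packet k X ↔ ∀ a ∈ X, X.erase a ∈ K := by
  rw [Finset.inter_eq_left]
  constructor
  · exact fun h a ha => h (erase_mem_packet hX ha)
  · intro h A hA
    obtain ⟨a, ha, rfl⟩ := (mem_packet hX).1 hA
    exact h a ha

theorem packet_inter_nonempty_iff (hX : X.card = k + 1) :
    (packet k X ∩ K).Nonempty ↔ ∃ a ∈ X, X.erase a ∈ K := by
  constructor
  · rintro ⟨A, hA⟩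
    rw [Finset.mem_inter] at hA
    obtain ⟨a, ha, rfl⟩ := (mem_packet hX).1 hA.1
    exact ⟨a, ha, hA.2⟩
  · rintro ⟨a, ha, h⟩
    exact ⟨_, Finset.mem_inter.2 ⟨erase_mem_packet hX ha, h⟩⟩

theorem mem_full : X ∈ full k K ↔ X.card = k + 1 ∧ ∀ a ∈ X, X.erase a ∈ K := by
  rw [full, Finset.mem_filter, mem_C]
  exact and_congr_right fun h => packet_inter_eq_iff h

theorem mem_empt : X ∈ empt k K ↔ X.card = k + 1 ∧ ∀ a ∈ X, X.erase a ∉ K := by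
  rw [empt, Finset.mem_filter, mem_C]
  refine and_congr_right fun h => ?_
  rw [← Finset.not_nonempty_iff_eq_empty, packet_inter_nonempty_iff h]
  push Not
  rfl

theorem mem_suf : X ∈ suf k K ↔ X.card = k + 1 ∧ Upper X K ∧ (∃ a ∈ X, X.erase a ∈ K) ∧
    ∃ a ∈ X, X.erase a ∉ K := by
  classical
  rw [suf, Finset.mem_filter, mem_C]
  refine and_congr_right fun h => ?_
  rw [IsSuffixAt, packet_inter_nonempty_iff h, Ne, packet_inter_eq_iff h]
  push Not
  constructor
  · rintro ⟨h1, h2, h3⟩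
    exact ⟨fun a ha b hb hab => h3 _ (erase_mem_packet h ha) _ (erase_mem_packet h hb)
      ((lexLT_erase ha hb).2 hab), h1, h2⟩
  · rintro ⟨h1, h2, h3⟩
    refine ⟨h2, h3, fun A hA B hB hAB => ?_⟩
    obtain ⟨a, ha, rfl⟩ := (mem_packet h).1 hA
    obtain ⟨b, hb, rfl⟩ := (mem_packet h).1 hB
    exact h1 a ha b hb ((lexLT_erase ha hb).1 hAB)

theorem mem_pre : X ∈ pre k K ↔ X.card = k + 1 ∧ Lower X K ∧ (∃ a ∈ X, X.erase a ∈ K) ∧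
    ∃ a ∈ X, X.erase a ∉ K := by
  classical
  rw [pre, Finset.mem_filter, mem_C]
  refine and_congr_right fun h => ?_
  rw [IsPrefixAt, packet_inter_nonempty_iff h, Ne, packet_inter_eq_iff h]
  push Not
  constructor
  · rintro ⟨h1, h2, h3⟩
    exact ⟨fun a ha b hb hab => h3 _ (erase_mem_packet h ha) _ (erase_mem_packet h hb)
      ((lexLT_erase ha hb).2 hab), h1, h2⟩
  · rintro ⟨h1, h2, h3⟩
    refine ⟨h2, h3, fun A hA B hB hAB => ?_⟩
    obtain ⟨a, ha, rfl⟩ := (mem_packet h).1 hA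
    obtain ⟨b, hb, rfl⟩ := (mem_packet h).1 hB
    exact h1 a ha b hb ((lexLT_erase ha hb).1 hAB)

theorem realizable_iff : Realizable k K ↔ K ⊆ C n k ∧ Consistent k K := by
  refine and_congr_right fun _ => ?_
  constructor
  · intro h X hX
    have hXC : X ∈ C n (k + 1) := mem_C.2 hX
    rw [← h] at hXC
    simp only [Finset.mem_union] at hXC
    rcases hXC with ((h | h) | h) | h
    · exact Or.inr (mem_suf.1 h).2.1
    · exact Or.inl (mem_pre.1 h).2.1
    · exact Or.inl fun a ha _ _ _ _ => (mem_full.1 h).2 a ha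
    · exact Or.inl fun a ha b hb _ hbK => absurd hbK ((mem_empt.1 h).2 b hb)
  · intro h
    ext X
    simp only [Finset.mem_union, mem_suf, mem_pre, mem_full, mem_empt, mem_C]
    constructor
    · rintro (((h | h) | h) | h) <;> exact h.1
    · intro hX
      by_cases h1 : ∃ a ∈ X, X.erase a ∈ K
      · by_cases h2 : ∃ a ∈ X, X.erase a ∉ K
        · rcases h X hX with h3 | h3
          · exact Or.inl (Or.inl (Or.inr ⟨hX, h3, h1, h2⟩))
          · exact Or.inl (Or.inl (Or.inl ⟨hX, h3, h1, h2⟩))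
        · push Not at h2
          exact Or.inl (Or.inr ⟨hX, h2⟩)
      · push Not at h1
        exact Or.inr ⟨hX, h1⟩

/-- Under consistency one pair "earlier face absent, later face present" already excludes the prefix
case, so suffix packets are detected by a single such pair. -/
theorem Consistent.mem_suf_iff (hK : Consistent k K) : X ∈ suf k K ↔ X.card = k + 1 ∧
    ∃ a ∈ X, ∃ b ∈ X, b < a ∧ X.erase a ∉ K ∧ X.erase b ∈ K := by
  rw [mem_suf]
  refine and_congr_right fun hX => ?_
  constructor
  · rintro ⟨h1, ⟨b, hb, hbK⟩, ⟨a, ha, haK⟩⟩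
    refine ⟨a, ha, b, hb, ?_, haK, hbK⟩
    rcases lt_trichotomy a b with h | h | h
    · exact absurd (h1 b hb a ha h hbK) haK
    · subst h; exact absurd hbK haK
    · exact h
  · rintro ⟨a, ha, b, hb, hab, haK, hbK⟩
    refine ⟨?_, ⟨b, hb, hbK⟩, ⟨a, ha, haK⟩⟩
    exact (hK X hX).resolve_left fun h => haK (h a ha b hb hab hbK)

/-- In a prefix or suffix the first and last faces tell everything: deleting the maximum gives the
first face, deleting the minimum the last. -/
theorem Consistent.mem_suf_iff_extremes (hK : Consistent k K) (hX : X.card = k + 1) {a b : Fin n}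
    (ha : a ∈ X) (ha' : ∀ x ∈ X, x ≤ a) (hb : b ∈ X) (hb' : ∀ x ∈ X, b ≤ x) :
    X ∈ suf k K ↔ X.erase a ∉ K ∧ X.erase b ∈ K := by
  rw [hK.mem_suf_iff]
  constructor
  · rintro ⟨-, c, hc, d, hd, hcd, hcK, hdK⟩
    have hu := (hK X hX).resolve_left fun h => hcK (h c hc d hd hcd hdK)
    constructor
    · intro h
      rcases (ha' c hc).eq_or_lt with rfl | h'
      · exact hcK h
      · exact hcK (hu a ha c hc h' h)
    · rcases (hb' d hd).eq_or_lt with rfl | h'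
      · exact hdK
      · exact hu d hd b hb h' hdK
  · rintro ⟨h1, h2⟩
    refine ⟨hX, a, ha, b, hb, lt_of_le_of_ne (ha' b hb) ?_, h1, h2⟩
    rintro rfl
    exact h1 h2

/-- A predicate on the elements of `X` without alternating triples is monotone or antitone. -/
theorem lower_or_upper_of_no_alternation
    (h1 : ∀ x ∈ X, ∀ y ∈ X, ∀ z ∈ X, z < y → y < x →
      ¬ (X.erase x ∈ K ∧ X.erase y ∉ K ∧ X.erase z ∈ K))
    (h2 : ∀ x ∈ X, ∀ y ∈ X, ∀ z ∈ X, z < y → y < x →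
      ¬ (X.erase x ∉ K ∧ X.erase y ∈ K ∧ X.erase z ∉ K)) : Lower X K ∨ Upper X K := by
  by_contra h
  rw [not_or] at h
  unfold Lower Upper at h
  push Not at h
  obtain ⟨⟨a, ha, b, hb, hba, hbK, haK⟩, ⟨c, hc, d, hd, hdc, hcK, hdK⟩⟩ := h
  rcases lt_trichotomy a c with h | h | h
  · exact h1 c hc a ha b hb hba h ⟨hcK, haK, hbK⟩
  · subst h; exact haK hcK
  · exact h2 a ha c hc d hd hdc h ⟨haK, hcK, hdK⟩

end Packets

/-! ### Suffix packets of a consistent family form a consistent family. -/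

section SuffixSets

variable {n k : ℕ} {K : Family n}

/-- Three faces of a face `Y.erase a` do not alternate between membership and non-membership. -/
theorem Consistent.no_alternation (hK : Consistent k K) {Y : Finset (Fin n)}
    (hY : Y.card = k + 2) {a x y z : Fin n} (ha : a ∈ Y) (hx : x ∈ Y) (hy : y ∈ Y) (hz : z ∈ Y)
    (hax : x ≠ a) (hay : y ≠ a) (haz : z ≠ a) (hzy : z < y) (hyx : y < x) :
    ¬ ((Y.erase a).erase x ∈ K ∧ (Y.erase a).erase y ∉ K ∧ (Y.erase a).erase z ∈ K) ∧
    ¬ ((Y.erase a).erase x ∉ K ∧ (Y.erase a).erase y ∈ K ∧ (Y.erase a).erase z ∉ K) := by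
  have hc : (Y.erase a).card = k + 1 := by rw [Finset.card_erase_of_mem ha]; omega
  have hx' : x ∈ Y.erase a := Finset.mem_erase.2 ⟨hax, hx⟩
  have hy' : y ∈ Y.erase a := Finset.mem_erase.2 ⟨hay, hy⟩
  have hz' : z ∈ Y.erase a := Finset.mem_erase.2 ⟨haz, hz⟩
  rcases hK _ hc with h | h
  · exact ⟨fun h' => h'.2.1 (h y hy' z hz' hzy h'.2.2), fun h' => h'.1 (h x hx' y hy' hyx h'.2.1)⟩
  · exact ⟨fun h' => h'.2.1 (h x hx' y hy' hyx h'.1), fun h' => h'.2.2 (h y hy' z hz' hzy h'.2.1)⟩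

/-- The faces of `Y` whose packets meet `K` in a proper suffix form an initial or final segment. -/
theorem Consistent.suf_no_alternation (hK : Consistent k K) {Y : Finset (Fin n)}
    (hY : Y.card = k + 2) {x y z : Fin n} (hx : x ∈ Y) (hy : y ∈ Y) (hz : z ∈ Y)
    (hzy : z < y) (hyx : y < x) :
    ¬ (Y.erase x ∈ suf k K ∧ Y.erase y ∉ suf k K ∧ Y.erase z ∈ suf k K) ∧
    ¬ (Y.erase x ∉ suf k K ∧ Y.erase y ∈ suf k K ∧ Y.erase z ∉ suf k K) := by
  -- The combinatorial core, with `e a b` standing for $Y\setminus\{a,b\}\in K$ and `s a` for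
  -- $Y\setminus a$ being a suffix packet. Symmetry of `e` lets information pass between different
  -- faces of `Y`.
  have key : ∀ e : Fin n → Fin n → Prop, (∀ a b, e a b → e b a) →
      (∀ a ∈ Y, ∀ x ∈ Y, ∀ y ∈ Y, ∀ z ∈ Y, x ≠ a → y ≠ a → z ≠ a → z < y → y < x →
        ¬ (e a x ∧ ¬ e a y ∧ e a z) ∧ ¬ (¬ e a x ∧ e a y ∧ ¬ e a z)) →
      ∀ s : Fin n → Prop,
        (∀ a ∈ Y, s a → ∀ c ∈ Y, ∀ d ∈ Y, c ≠ a → d ≠ a → d < c → e a c → e a d) →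
        (∀ a ∈ Y, ¬ s a → ∀ c ∈ Y, ∀ d ∈ Y, c ≠ a → d ≠ a → d < c → e a d → e a c) →
        (∀ a ∈ Y, s a → ∃ c ∈ Y, ∃ d ∈ Y, c ≠ a ∧ d ≠ a ∧ ¬ e a c ∧ e a d) →
        ¬ (s x ∧ ¬ s y ∧ s z) ∧ ¬ (¬ s x ∧ s y ∧ ¬ s z) := by
    intro e hsymm hno s hup hlow hex
    have hzx : z < x := hzy.trans hyx
    constructor
    · rintro ⟨sx, sy, sz⟩
      obtain ⟨a, ha, b', hb', hax, hb'x, hexa, hexb'⟩ := hex x hx sx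
      obtain ⟨a', ha', b, hb, ha'z, hbz, heza', hezb⟩ := hex z hz sz
      by_cases h : e x y
      · have hxz := hup x hx sx y hy z hz hyx.ne hzx.ne hzy h
        have hya : y < a := by
          rcases lt_trichotomy a y with h' | rfl | h'
          · exact absurd (hup x hx sx y hy a ha hyx.ne hax h' h) hexa
          · exact absurd h hexa
          · exact h'
        have hzx' := hsymm _ _ hxz
        have hxa' : x < a' := by
          rcases lt_trichotomy a' x with h' | rfl | h'
          · exact absurd (hup z hz sz x hx a' ha' hzx.ne' ha'z h' hzx') heza'
          · exact absurd hzx' heza'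
          · exact h'
        have hya' := hlow y hy sy a' ha' x hx (hyx.trans hxa').ne' hyx.ne' hxa' (hsymm _ _ h)
        have ha'x : e a' x := by
          by_contra h'
          exact (hno a' ha' x hx y hy z hz hxa'.ne (hyx.trans hxa').ne (hzx.trans hxa').ne
            hzy hyx).2 ⟨h', hsymm _ _ hya', fun h'' => heza' (hsymm _ _ h'')⟩
        have haa' : a' < a := by
          rcases lt_trichotomy a a' with h' | rfl | h'
          · exact absurd (hup x hx sx a' ha' a ha hxa'.ne' hax h' (hsymm _ _ ha'x)) hexa
          · exact absurd (hsymm _ _ ha'x) hexa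
          · exact h'
        have hxa := hxa'.trans haa'
        have hya2 := hlow y hy sy a ha x hx hya.ne' hyx.ne' hxa (hsymm _ _ h)
        have haz : e a z := by
          by_contra h'
          exact (hno a ha x hx y hy z hz hxa.ne hya.ne (hzy.trans hya).ne hzy hyx).2
            ⟨fun h'' => hexa (hsymm _ _ h''), hsymm _ _ hya2, h'⟩
        exact heza' (hup z hz sz a ha a' ha' (hzy.trans hya).ne' ha'z haa' (hsymm _ _ haz))
      -- In the mirror case the presence witnesses are forced below `z`, with `b < b'`, and the face
      -- at `b` alternates.
      · have hyz : ¬ e y z := fun h' =>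
          h (hsymm _ _ (hlow y hy sy x hx z hz hyx.ne' hzy.ne hzx h'))
        have hzx' : ¬ e z x := fun h' =>
          hyz (hsymm _ _ (hup z hz sz x hx y hy hzx.ne' hzy.ne' hyx h'))
        have hb'z : b' < z := by
          rcases lt_trichotomy b' z with h' | rfl | h'
          · exact h'
          · exact absurd (hsymm _ _ hexb') hzx'
          · exact absurd (hsymm _ _ (hup x hx sx b' hb' z hz hb'x hzx.ne h' hexb')) hzx'
        have hyb' : ¬ e y b' := fun h' => h (hsymm _ _
          (hlow y hy sy x hx b' hb' hyx.ne' (hb'z.trans hzy).ne (hb'z.trans hzx) h'))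
        have hzb' : ¬ e b' z := fun h' =>
          (hno b' hb' x hx y hy z hz hb'x.symm (hb'z.trans hzy).ne' hb'z.ne' hzy hyx).1
            ⟨hsymm _ _ hexb', fun h'' => hyb' (hsymm _ _ h''), h'⟩
        have hbb' : b < b' := by
          rcases lt_trichotomy b b' with h' | rfl | h'
          · exact h'
          · exact absurd (hsymm _ _ hezb) hzb'
          · exact absurd (hsymm _ _ (hup z hz sz b hb b' hb' hbz hb'z.ne h' hezb)) hzb'
        have hbz' := hbb'.trans hb'z
        have hyb : ¬ e y b := fun h' => h (hsymm _ _
          (hlow y hy sy x hx b hb hyx.ne' (hbz'.trans hzy).ne (hbz'.trans hzx) h'))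
        have hxb := hup x hx sx b' hb' b hb hb'x (hbz'.trans hzx).ne hbb' hexb'
        exact (hno b hb x hx y hy z hz (hbz'.trans hzx).ne' (hbz'.trans hzy).ne' hbz'.ne'
          hzy hyx).1 ⟨hsymm _ _ hxb, fun h'' => hyb (hsymm _ _ h''), hsymm _ _ hezb⟩
    · rintro ⟨sx, sy, sz⟩
      obtain ⟨a, ha, b, hb, hay, hby, heya, heyb⟩ := hex y hy sy
      -- For the pattern no, yes, no, a single witness of `y` suffices: it falls beyond `x` or below
      -- `z`, and its own face then alternates.
      by_cases h : e y x
      · have hyz := hup y hy sy x hx z hz hyx.ne' hzy.ne hzx h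
        have hxa : x < a := by
          rcases lt_trichotomy a x with h' | rfl | h'
          · exact absurd (hup y hy sy x hx a ha hyx.ne' hay h' h) heya
          · exact absurd h heya
          · exact h'
        have hzx' := hlow z hz sz x hx y hy hzx.ne' hzy.ne' hyx (hsymm _ _ hyz)
        have hza := hlow z hz sz a ha y hy (hzx.trans hxa).ne' hzy.ne' (hyx.trans hxa)
          (hsymm _ _ hyz)
        have hxa' := hlow x hx sx a ha z hz hxa.ne' hzx.ne (hzx.trans hxa) (hsymm _ _ hzx')
        exact (hno a ha x hx y hy z hz hxa.ne hay.symm (hzx.trans hxa).ne hzy hyx).1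
          ⟨hsymm _ _ hxa', fun h' => heya (hsymm _ _ h'), hsymm _ _ hza⟩
      · have hxy : ¬ e x y := fun h' => h (hsymm _ _ h')
        by_cases h2 : e y z
        · have h3 := hlow z hz sz x hx y hy hzx.ne' hzy.ne' hyx (hsymm _ _ h2)
          exact hxy (hlow x hx sx y hy z hz hyx.ne hzx.ne hzy (hsymm _ _ h3))
        · have hbz : b < z := by
            rcases lt_trichotomy b z with h' | rfl | h'
            · exact h'
            · exact absurd heyb h2
            · exact absurd (hup y hy sy b hb z hz hby hzy.ne h' heyb) h2
          have hzb : ¬ e z b := fun h' => h2 (hsymm _ _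
            (hlow z hz sz y hy b hb hzy.ne' hbz.ne (hbz.trans hzy) h'))
          have hxb : ¬ e x b := fun h' => hxy
            (hlow x hx sx y hy b hb hyx.ne (hbz.trans hzx).ne (hbz.trans hzy) h')
          exact (hno b hb x hx y hy z hz (hbz.trans hzx).ne' hby.symm hbz.ne' hzy hyx).2
            ⟨fun h' => hxb (hsymm _ _ h'), hsymm _ _ heyb, fun h' => hzb (hsymm _ _ h')⟩
  have hc : ∀ a ∈ Y, (Y.erase a).card = k + 1 := fun a ha => by
    rw [Finset.card_erase_of_mem ha]; omega
  refine key (fun a b => (Y.erase a).erase b ∈ K)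
    (fun a b h => by rwa [Finset.erase_right_comm]) ?_ (fun a => Y.erase a ∈ suf k K) ?_ ?_ ?_
  · intro a ha x hx y hy z hz hxa hya hza hzy hyx
    exact hK.no_alternation hY ha hx hy hz hxa hya hza hzy hyx
  · intro a ha hs c hc d hd hca hda hdc
    exact (mem_suf.1 hs).2.1 c (Finset.mem_erase.2 ⟨hca, hc⟩) d (Finset.mem_erase.2 ⟨hda, hd⟩) hdc
  · intro a ha hs c hc' d hd hca hda hdc hed
    by_contra hec
    exact hs (hK.mem_suf_iff.2 ⟨hc a ha, c, Finset.mem_erase.2 ⟨hca, hc'⟩, d,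
      Finset.mem_erase.2 ⟨hda, hd⟩, hdc, hec, hed⟩)
  · intro a ha hs
    obtain ⟨-, -, ⟨d, hd, hdK⟩, ⟨c, hc, hcK⟩⟩ := mem_suf.1 hs
    rw [Finset.mem_erase] at hc hd
    exact ⟨c, hc.2, d, hd.2, hc.1, hd.1, hcK, hdK⟩

theorem Consistent.suf (hK : Consistent k K) : Consistent (k + 1) (suf k K) := by
  intro Y hY
  exact lower_or_upper_of_no_alternation
    (fun x hx y hy z hz hzy hyx => (hK.suf_no_alternation hY hx hy hz hzy hyx).1)
    (fun x hx y hy z hz hzy hyx => (hK.suf_no_alternation hY hx hy hz hzy hyx).2)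

end SuffixSets

/-! ### Consistent families as inversion sets of rankings. -/

section Ranking

variable {n : ℕ}

/-- `f` ranks `k`-sets so that the packet of `X` is ranked antilexicographically if `X ∈ U` and
lexicographically otherwise. -/
def Ranks (k : ℕ) (U : Family n) (f : Finset (Fin n) → ℕ) : Prop :=
  ∀ X : Finset (Fin n), X.card = k + 1 → ∀ a ∈ X, ∀ b ∈ X, a < b →
    (X ∈ U → f (X.erase a) < f (X.erase b)) ∧ (X ∉ U → f (X.erase b) < f (X.erase a))

/-- Induction on the number `t` of ground elements in use. The sets containing the new last element
`p` are ranked through the link of `p` and put in a middle band; a set `A` avoiding `p` goes above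
or below that band according to whether `insert p A ∈ U`. -/
theorem exists_ranking_below (t : ℕ) : ∀ (k : ℕ) (U : Family n),
    (∀ Y : Finset (Fin n), (∀ y ∈ Y, y.val < t) → Y.card = k + 2 → Lower Y U ∨ Upper Y U) →
    ∃ f : Finset (Fin n) → ℕ, ∀ X : Finset (Fin n), (∀ x ∈ X, x.val < t) → X.card = k + 1 →
      ∀ a ∈ X, ∀ b ∈ X, a < b →
        (X ∈ U → f (X.erase a) < f (X.erase b)) ∧ (X ∉ U → f (X.erase b) < f (X.erase a)) := by
  induction t with
  | zero =>
    intro k U _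
    exact ⟨fun _ => 0, fun X hX _ a ha => absurd (hX a ha) (Nat.not_lt_zero _)⟩
  | succ t ih =>
    intro k U hU
    rcases k with _ | k
    · refine ⟨fun _ => 0, fun X _ hc a ha b hb hab => ?_⟩
      exact absurd (Finset.card_le_one.1 hc.le a ha b hb) hab.ne
    by_cases ht : t < n
    swap
    · have hlt : ∀ x : Fin n, x.val < t := fun x => by omega
      obtain ⟨f, hf⟩ := ih (k + 1) U fun Y _ hc => hU Y (fun y _ => (hlt y).trans t.lt_succ_self) hc
      exact ⟨f, fun X _ hc => hf X (fun x _ => hlt x) hc⟩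
    let p : Fin n := ⟨t, ht⟩
    have hlt : ∀ x : Fin n, x.val < t + 1 → x ≠ p → x.val < t := fun x h1 h2 => by
      have : x.val ≠ t := fun h => h2 (Fin.ext h)
      omega
    have hnotmem : ∀ Y : Finset (Fin n), (∀ y ∈ Y, y.val < t) → p ∉ Y := fun Y hY hp =>
      absurd (hY p hp) (lt_irrefl _)
    have hins : ∀ Y : Finset (Fin n), (∀ y ∈ Y, y.val < t) → ∀ y ∈ insert p Y, y.val < t + 1 := by
      intro Y hY y hy
      rcases Finset.mem_insert.1 hy with rfl | hy
      · exact t.lt_succ_self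
      · exact (hY y hy).trans t.lt_succ_self
    classical
    -- The link of `p` in `U`; its packets are those of `U` around sets containing `p`, with the
    -- face omitting `p` removed, so consistency is inherited.
    let W : Family n := Finset.univ.filter fun A => insert p A ∈ U
    have hW : ∀ A, A ∈ W ↔ insert p A ∈ U := fun A => by simp [W]
    have hers : ∀ Y : Finset (Fin n), ∀ a ∈ Y, p ∉ Y →
        insert p (Y.erase a) = (insert p Y).erase a := by
      intro Y a ha hp
      rw [Finset.erase_insert_of_ne]
      rintro rfl
      exact hp ha
    obtain ⟨h, hh⟩ := ih (k + 1) U fun Y hY hc =>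
      hU Y (fun y hy => (hY y hy).trans t.lt_succ_self) hc
    obtain ⟨g, hg⟩ := ih k W (by
      intro Y hY hc
      have hp := hnotmem Y hY
      refine (hU (insert p Y) (hins Y hY) (by rw [Finset.card_insert_of_notMem hp, hc])).imp ?_ ?_
      all_goals
        intro H a ha b hb hab hm
        rw [hW, hers Y _ (by assumption) hp] at hm ⊢
        exact H a (Finset.mem_insert_of_mem ha) b (Finset.mem_insert_of_mem hb) hab hm)
    -- A strict bound for both rankings, so that the bands starting at `0`, `B` and `2 * B` are
    -- disjoint.
    let B : ℕ := Finset.univ.sup (fun A => max (h A) (g A)) + 1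
    have hB : ∀ A, h A < B ∧ g A < B := by
      intro A
      have : max (h A) (g A) ≤ Finset.univ.sup (fun A => max (h A) (g A)) :=
        Finset.le_sup (f := fun A => max (h A) (g A)) (Finset.mem_univ A)
      omega
    let f : Finset (Fin n) → ℕ := fun A =>
      if p ∈ A then B + g (A.erase p) else if insert p A ∈ U then 2 * B + h A else h A
    have f1 : ∀ A, p ∈ A → f A = B + g (A.erase p) := fun A hA => by simp [f, hA]
    have f2 : ∀ A, p ∉ A → insert p A ∈ U → f A = 2 * B + h A := fun A hA hA' => by
      simp [f, hA, hA']
    have f3 : ∀ A, p ∉ A → insert p A ∉ U → f A = h A := fun A hA hA' => by simp [f, hA, hA']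
    refine ⟨f, fun X hX hc a ha b hb hab => ?_⟩
    by_cases hp : p ∈ X
    · have hap : a ≠ p := by
        rintro rfl
        have := hX b hb
        have : p.val < b.val := hab
        have : p.val = t := rfl
        omega
      have hpa : p ∈ X.erase a := Finset.mem_erase.2 ⟨hap.symm, hp⟩
      rw [f1 _ hpa]
      have hZ : ∀ x ∈ X.erase p, x.val < t := fun x hx =>
        hlt x (hX x (Finset.mem_of_mem_erase hx)) (Finset.ne_of_mem_erase hx)
      have hZc : (X.erase p).card = k + 1 := by rw [Finset.card_erase_of_mem hp, hc]; rfl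
      have haB := hB ((X.erase a).erase p)
      by_cases hbp : b = p
      · subst hbp
        have hpp : p ∉ X.erase p := Finset.notMem_erase _ _
        have hXe : insert p (X.erase p) = X := Finset.insert_erase hp
        have hb2 := hB (X.erase p)
        constructor
        · intro hXU
          rw [f2 _ hpp (by rwa [hXe])]
          omega
        · intro hXU
          rw [f3 _ hpp (by rwa [hXe])]
          omega
      · have hpb : p ∈ X.erase b := Finset.mem_erase.2 ⟨fun h => hbp h.symm, hp⟩
        rw [f1 _ hpb, Finset.erase_right_comm (a := a), Finset.erase_right_comm (a := b)]
        have := hg _ hZ hZc a (Finset.mem_erase.2 ⟨hap, ha⟩) b (Finset.mem_erase.2 ⟨hbp, hb⟩) hab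
        rw [hW, Finset.insert_erase hp] at this
        exact ⟨fun h => Nat.add_lt_add_left (this.1 h) _,
          fun h => Nat.add_lt_add_left (this.2 h) _⟩
    · have hX' : ∀ x ∈ X, x.val < t := fun x hx => hlt x (hX x hx) fun h => hp (h ▸ hx)
      have hpe : ∀ c, p ∉ X.erase c := fun c h => hp (Finset.mem_of_mem_erase h)
      have hcons := hU (insert p X) (hins X hX') (by
        rw [Finset.card_insert_of_notMem hp, hc])
      have hpX : (insert p X).erase p = X := Finset.erase_insert hp
      have hlast : ∀ c ∈ X, c < p := fun c hc => hX' c hc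
      have hmem : ∀ c ∈ X, c ∈ insert p X := fun c hc => Finset.mem_insert_of_mem hc
      have hpm : p ∈ insert p X := Finset.mem_insert_self _ _
      have hf := hh X hX' hc a ha b hb hab
      have ea := hers X a ha hp
      have eb := hers X b hb hp
      have hBa := hB (X.erase a)
      have hBb := hB (X.erase b)
      constructor
      · intro hXU
        -- `X` is the first face of `insert p X`. Its membership in `U` fixes in which direction the
        -- band can change along the packet of `X`, and this agrees with the direction required
        -- inside a band.
        have himp : insert p (X.erase a) ∈ U → insert p (X.erase b) ∈ U := by
          rw [ea, eb]
          intro h1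
          rcases hcons with H | H
          · exact H b (hmem b hb) a (hmem a ha) hab h1
          · exact H p hpm b (hmem b hb) (hlast b hb) (by rwa [hpX])
        have := hf.1 hXU
        by_cases h1 : insert p (X.erase a) ∈ U
        · rw [f2 _ (hpe a) h1, f2 _ (hpe b) (himp h1)]; omega
        · rw [f3 _ (hpe a) h1]
          by_cases h2 : insert p (X.erase b) ∈ U
          · rw [f2 _ (hpe b) h2]; omega
          · rw [f3 _ (hpe b) h2]; omega
      · intro hXU
        have himp : insert p (X.erase b) ∈ U → insert p (X.erase a) ∈ U := by
          rw [ea, eb]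
          intro h1
          rcases hcons with H | H
          · exact absurd (H p hpm b (hmem b hb) (hlast b hb) h1) (by rwa [hpX])
          · exact H b (hmem b hb) a (hmem a ha) hab h1
        have := hf.2 hXU
        by_cases h1 : insert p (X.erase b) ∈ U
        · rw [f2 _ (hpe b) h1, f2 _ (hpe a) (himp h1)]; omega
        · rw [f3 _ (hpe b) h1]
          by_cases h2 : insert p (X.erase a) ∈ U
          · rw [f2 _ (hpe a) h2]; omega
          · rw [f3 _ (hpe a) h2]; omega

/-- A consistent family of `(k+1)`-sets is the inversion set of a ranking of the `k`-sets. -/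
theorem Consistent.exists_ranks {k : ℕ} {U : Family n} (hU : Consistent (k + 1) U) :
    ∃ f, Ranks k U f := by
  obtain ⟨f, hf⟩ := exists_ranking_below n k U fun Y _ hc => hU Y hc
  exact ⟨f, fun X hc => hf X (fun x _ => x.isLt) hc⟩

end Ranking

/-! ### Cliques, pivots and the parity of the top clique. -/

section Cliques

variable {n : ℕ} {J : Family n} {X Y : Finset (Fin n)} {q m : Fin n}

/-- All pairs in `X` belong to `J`. -/
def IsClique (J : Family n) (X : Finset (Fin n)) : Prop :=
  ∀ a ∈ X, ∀ b ∈ X, a < b → {a, b} ∈ J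

open Classical in
/-- The largest final segment of `X` that is a clique. -/
noncomputable def topClique (J : Family n) (X : Finset (Fin n)) : Finset (Fin n) :=
  X.filter fun x => ∀ a ∈ X, ∀ b ∈ X, x ≤ a → a < b → {a, b} ∈ J

theorem mem_topClique {x : Fin n} : x ∈ topClique J X ↔
    x ∈ X ∧ ∀ a ∈ X, ∀ b ∈ X, x ≤ a → a < b → {a, b} ∈ J := by
  classical
  rw [topClique, Finset.mem_filter]

theorem topClique_upward {x y : Fin n} (hx : x ∈ topClique J X) (hy : y ∈ X) (hxy : x ≤ y) :
    y ∈ topClique J X := by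
  rw [mem_topClique] at hx ⊢
  exact ⟨hy, fun a ha b hb hya => hx.2 a ha b hb (hxy.trans hya)⟩

theorem isClique_iff : IsClique J X ↔ ∀ x ∈ X, x ∈ topClique J X := by
  constructor
  · exact fun h x hx => mem_topClique.2 ⟨hx, fun a ha b hb _ hab => h a ha b hb hab⟩
  · exact fun h a ha b hb hab => (mem_topClique.1 (h a ha)).2 a ha b hb le_rfl hab

theorem IsClique.mono (h : IsClique J Y) (hXY : X ⊆ Y) : IsClique J X :=
  fun a ha b hb => h a (hXY ha) b (hXY hb)

/-- In the lexicographic packet `{a, b}`, `{a, c}`, `{b, c}` a prefix or suffix cannot separate the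
middle pair from both outer ones. This is the condition on inversion sets of permutations. -/
theorem consistent_triple (hJ : Realizable 2 J) {a b c : Fin n} (hab : a < b) (hbc : b < c) :
    ({a, b} ∈ J → {b, c} ∈ J → {a, c} ∈ J) ∧ ({a, c} ∈ J → {a, b} ∈ J ∨ {b, c} ∈ J) := by
  have hac := hab.trans hbc
  have h1 : ({a, b, c} : Finset (Fin n)).erase a = {b, c} := by
    ext x; simp only [Finset.mem_erase, Finset.mem_insert, Finset.mem_singleton]; grind
  have h2 : ({a, b, c} : Finset (Fin n)).erase b = {a, c} := by
    ext x; simp only [Finset.mem_erase, Finset.mem_insert, Finset.mem_singleton]; grind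
  have h3 : ({a, b, c} : Finset (Fin n)).erase c = {a, b} := by
    ext x; simp only [Finset.mem_erase, Finset.mem_insert, Finset.mem_singleton]; grind
  have hc := (realizable_iff.1 hJ).2 {a, b, c} (Finset.card_eq_three.2
    ⟨a, b, c, hab.ne, hac.ne, hbc.ne, rfl⟩)
  rw [← h1, ← h2, ← h3]
  have ha : a ∈ ({a, b, c} : Finset (Fin n)) := by simp
  have hb : b ∈ ({a, b, c} : Finset (Fin n)) := by simp
  have hc' : c ∈ ({a, b, c} : Finset (Fin n)) := by simp
  rcases hc with H | H
  · exact ⟨fun _ h => H b hb a ha hab h, fun h => Or.inl (H c hc' b hb hbc h)⟩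
  · exact ⟨fun h _ => H c hc' b hb hbc h, fun h => Or.inr (H b hb a ha hab h)⟩

/-- `q < m` are neighbours in `Y`, the pair `q, m` is not in `J`, and the elements of `Y` from `m`
on form a clique. -/
structure Pivot (J : Family n) (Y : Finset (Fin n)) (q m : Fin n) : Prop where
  left_mem : q ∈ Y
  right_mem : m ∈ Y
  lt : q < m
  not_mem : {q, m} ∉ J
  le_or_ge : ∀ y ∈ Y, y ≤ q ∨ m ≤ y
  clique : ∀ a ∈ Y, ∀ b ∈ Y, m ≤ a → a < b → {a, b} ∈ J

/-- Take the least element `m` of the top clique and the largest element `q` outside it. If `{q, m}`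
were in `J`, transitivity of inversions would extend the clique to `q`. -/
theorem exists_pivot (hJ : Realizable 2 J) (hY : ¬ IsClique J Y) : ∃ q m, Pivot J Y q m := by
  have hne : (Y \ topClique J Y).Nonempty := by
    rw [Finset.sdiff_nonempty]
    exact fun h => hY (isClique_iff.2 h)
  have hne' : Y.Nonempty := hne.mono Finset.sdiff_subset
  have htop : (topClique J Y).Nonempty := by
    refine ⟨Y.max' hne', mem_topClique.2 ⟨Y.max'_mem _, fun a ha b hb h1 h2 => ?_⟩⟩
    exact absurd (h1.trans_lt h2) (not_lt.2 (Y.le_max' b hb))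
  let m := (topClique J Y).min' htop
  let q := (Y \ topClique J Y).max' hne
  have hm : m ∈ topClique J Y := Finset.min'_mem _ _
  have hq : q ∈ Y \ topClique J Y := Finset.max'_mem _ _
  rw [Finset.mem_sdiff] at hq
  have hqm : q < m := by
    by_contra h
    exact hq.2 (topClique_upward hm hq.1 (not_lt.1 h))
  have hle : ∀ y ∈ Y, y ≤ q ∨ m ≤ y := by
    intro y hy
    by_cases h : y ∈ topClique J Y
    · exact Or.inr (Finset.min'_le _ _ h)
    · exact Or.inl (Finset.le_max' _ _ (Finset.mem_sdiff.2 ⟨hy, h⟩))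
  have hm' := mem_topClique.1 hm
  refine ⟨q, m, hq.1, hm'.1, hqm, fun hadj => hq.2 (mem_topClique.2 ⟨hq.1, ?_⟩), hle, hm'.2⟩
  intro a ha b hb hqa hab
  rcases hqa.eq_or_lt with rfl | hqa
  · have hmb := (hle b hb).resolve_left (not_le.2 hab)
    rcases hmb.eq_or_lt with hmb | hmb
    · rw [← hmb]; exact hadj
    · exact (consistent_triple hJ hqm hmb).1 hadj (hm'.2 m hm'.1 b hb le_rfl hmb)
  · exact hm'.2 a ha b hb ((hle a ha).resolve_left (not_le.2 hqa)) hab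

namespace Pivot

theorem not_isClique (h : Pivot J Y q m) : ¬ IsClique J Y :=
  fun hc => h.not_mem (hc q h.left_mem m h.right_mem h.lt)

theorem mem_topClique_iff (h : Pivot J Y q m) {z : Fin n} :
    z ∈ topClique J Y ↔ z ∈ Y ∧ m ≤ z := by
  rw [mem_topClique]
  refine and_congr_right fun hz => ?_
  constructor
  · intro H
    refine (h.le_or_ge z hz).resolve_left fun hzq => ?_
    exact h.not_mem (H q h.left_mem m h.right_mem hzq h.lt)
  · exact fun hmz a ha b hb hza => h.clique a ha b hb (hmz.trans hza)

/-- Only the twins move the pivot. Hence the parity of the top clique of every other face depends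
only on which side of the pivot the deleted element lies. -/
theorem erase (h : Pivot J Y q m) {z : Fin n} (hzq : z ≠ q) (hzm : z ≠ m) :
    Pivot J (Y.erase z) q m where
  left_mem := Finset.mem_erase.2 ⟨hzq.symm, h.left_mem⟩
  right_mem := Finset.mem_erase.2 ⟨hzm.symm, h.right_mem⟩
  lt := h.lt
  not_mem := h.not_mem
  le_or_ge y hy := h.le_or_ge y (Finset.mem_of_mem_erase hy)
  clique a ha b hb := h.clique a (Finset.mem_of_mem_erase ha) b (Finset.mem_of_mem_erase hb)

theorem topClique_erase (h : Pivot J Y q m) {z : Fin n} (hzq : z ≠ q) (hzm : z ≠ m) :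
    topClique J (Y.erase z) = (topClique J Y).erase z := by
  ext x
  rw [(h.erase hzq hzm).mem_topClique_iff, Finset.mem_erase, Finset.mem_erase,
    h.mem_topClique_iff, and_assoc]

theorem right_mem_topClique (h : Pivot J Y q m) : m ∈ topClique J Y :=
  h.mem_topClique_iff.2 ⟨h.right_mem, le_rfl⟩

theorem even_card_erase_of_gt (h : Pivot J Y q m) {z : Fin n} (hz : z ∈ Y) (hmz : m < z) :
    Even (topClique J (Y.erase z)).card ↔ Odd (topClique J Y).card := by
  rw [h.topClique_erase (h.lt.trans hmz).ne' hmz.ne']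
  have hz' : z ∈ topClique J Y := h.mem_topClique_iff.2 ⟨hz, hmz.le⟩
  rw [← Finset.card_erase_add_one hz', Nat.odd_add_one, Nat.not_odd_iff_even]

theorem even_card_erase_of_lt (h : Pivot J Y q m) {z : Fin n} (hzq : z < q) :
    Even (topClique J (Y.erase z)).card ↔ Even (topClique J Y).card := by
  rw [h.topClique_erase hzq.ne (hzq.trans h.lt).ne, Finset.erase_eq_of_notMem]
  exact fun hz => absurd (h.mem_topClique_iff.1 hz).2 (not_le.2 (hzq.trans h.lt))

/-- An even top clique has an element beyond the pivot. -/
theorem exists_gt (h : Pivot J Y q m) (he : Even (topClique J Y).card) : ∃ z ∈ Y, m < z := by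
  by_contra hcon
  push Not at hcon
  have : topClique J Y = {m} := by
    ext z
    rw [h.mem_topClique_iff, Finset.mem_singleton]
    constructor
    · exact fun hz => le_antisymm (hcon z hz.1) hz.2
    · rintro rfl; exact ⟨h.right_mem, le_rfl⟩
  rw [this, Finset.card_singleton] at he
  exact absurd he (by decide)

end Pivot

/-- Membership in `L^i`, for `i`-sets. -/
def InL (J : Family n) (X : Finset (Fin n)) : Prop :=
  ¬ IsClique J X ∧ Even (topClique J X).card

/-- Membership in `M^i`, for `i`-sets. -/
def InM (J : Family n) (X : Finset (Fin n)) : Prop :=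
  IsClique J X ∨ Even (topClique J X).card

theorem InL.inM (h : InL J X) : InM J X := Or.inr h.2

theorem InM.inL (h : InM J X) (hX : ¬ IsClique J X) : InL J X := ⟨hX, h.resolve_left hX⟩

namespace Pivot

theorem inL_erase_of_gt (h : Pivot J Y q m) {z : Fin n} (hz : z ∈ Y) (hmz : m < z) :
    InL J (Y.erase z) ↔ Odd (topClique J Y).card := by
  rw [InL, h.even_card_erase_of_gt hz hmz]
  exact and_iff_right (h.erase (h.lt.trans hmz).ne' hmz.ne').not_isClique

theorem inM_erase_of_gt (h : Pivot J Y q m) {z : Fin n} (hz : z ∈ Y) (hmz : m < z) :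
    InM J (Y.erase z) ↔ Odd (topClique J Y).card := by
  rw [InM, h.even_card_erase_of_gt hz hmz]
  exact or_iff_right (h.erase (h.lt.trans hmz).ne' hmz.ne').not_isClique

theorem inL_erase_of_lt (h : Pivot J Y q m) {z : Fin n} (hzq : z < q) :
    InL J (Y.erase z) ↔ Even (topClique J Y).card := by
  rw [InL, h.even_card_erase_of_lt hzq]
  exact and_iff_right (h.erase hzq.ne (hzq.trans h.lt).ne).not_isClique

theorem inM_erase_of_lt (h : Pivot J Y q m) {z : Fin n} (hzq : z < q) :
    InM J (Y.erase z) ↔ Even (topClique J Y).card := by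
  rw [InM, h.even_card_erase_of_lt hzq]
  exact or_iff_right (h.erase hzq.ne (hzq.trans h.lt).ne).not_isClique

theorem inL_iff (h : Pivot J Y q m) : InL J Y ↔ Even (topClique J Y).card :=
  and_iff_right h.not_isClique

theorem inM_iff (h : Pivot J Y q m) : InM J Y ↔ Even (topClique J Y).card :=
  or_iff_right h.not_isClique

theorem right_mem_topClique_erase (h : Pivot J Y q m) : m ∈ topClique J (Y.erase q) :=
  mem_topClique.2 ⟨Finset.mem_erase.2 ⟨h.lt.ne', h.right_mem⟩, fun a ha b hb =>
    h.clique a (Finset.mem_of_mem_erase ha) b (Finset.mem_of_mem_erase hb)⟩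

/-- If the top cliques of both twins pass the pivot, they correspond to each other. -/
theorem topClique_twin (hJ : Realizable 2 J) (h : Pivot J Y q m)
    (hq : q ∈ topClique J (Y.erase m)) {x : Fin n} (hx : x ∈ topClique J (Y.erase q))
    (hxq : x < q) {w : Fin n} (hwq : w ≠ q) (hwm : w ≠ m) :
    w ∈ topClique J (Y.erase q) ↔ w ∈ topClique J (Y.erase m) := by
  have hx' := mem_topClique.1 hx
  have hq' := mem_topClique.1 hq
  have hmq : m ∈ Y.erase q := Finset.mem_erase.2 ⟨h.lt.ne', h.right_mem⟩
  constructor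
  · intro hw
    have hw' := mem_topClique.1 hw
    refine mem_topClique.2 ⟨Finset.mem_erase.2 ⟨hwm, Finset.mem_of_mem_erase hw'.1⟩, ?_⟩
    intro a ha b hb hwa hab
    rw [Finset.mem_erase] at ha hb
    by_cases haq : a = q
    · subst haq
      exact hq'.2 a (Finset.mem_erase.2 ha) b (Finset.mem_erase.2 hb) le_rfl hab
    have ha' : a ∈ Y.erase q := Finset.mem_erase.2 ⟨haq, ha.2⟩
    by_cases hbq : b = q
    · subst hbq
      -- An inversion of `a` with `m` passes to the element between them that is not inverted with
      -- `m`.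
      have ham := hw'.2 a ha' m hmq hwa (hab.trans h.lt)
      exact ((consistent_triple hJ hab h.lt).2 ham).resolve_right h.not_mem
    · exact hw'.2 a ha' b (Finset.mem_erase.2 ⟨hbq, hb.2⟩) hwa hab
  · intro hw
    have hw' := mem_topClique.1 hw
    refine mem_topClique.2 ⟨Finset.mem_erase.2 ⟨hwq, Finset.mem_of_mem_erase hw'.1⟩, ?_⟩
    intro a ha b hb hwa hab
    rw [Finset.mem_erase] at ha hb
    by_cases ham : a = m
    · exact h.clique a ha.2 b hb.2 ham.ge hab
    have ha' : a ∈ Y.erase m := Finset.mem_erase.2 ⟨ham, ha.2⟩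
    by_cases hbm : b = m
    · rw [hbm] at hab ⊢
      -- The element `x` is inverted with `m` and serves as a bridge for those `a` that lie below
      -- it.
      rcases le_or_gt x a with hxa | hax
      · exact hx'.2 a (Finset.mem_erase.2 ha) m hmq hxa hab
      · have hxm : x < m := hxq.trans h.lt
        have h1 := hw'.2 a ha' x
          (Finset.mem_erase.2 ⟨hxm.ne, Finset.mem_of_mem_erase hx'.1⟩) hwa hax
        exact (consistent_triple hJ hax hxm).1 h1 (hx'.2 x hx'.1 m hmq le_rfl hxm)
    · exact hw'.2 a ha' b (Finset.mem_erase.2 ⟨hbm, hb.2⟩) hwa hab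

/-- The top cliques of the twins differ only by exchanging `m` for `q`, so they have the same size
and are full simultaneously. -/
theorem inL_inM_twin (hJ : Realizable 2 J) (h : Pivot J Y q m)
    (hq : q ∈ topClique J (Y.erase m)) {x : Fin n} (hx : x ∈ topClique J (Y.erase q))
    (hxq : x < q) : (InL J (Y.erase q) ↔ InL J (Y.erase m)) ∧
      (InM J (Y.erase q) ↔ InM J (Y.erase m)) := by
  have hmt := h.right_mem_topClique_erase
  have key := fun w hwq hwm => h.topClique_twin hJ hq hx hxq (w := w) hwq hwm
  have hcl : IsClique J (Y.erase q) ↔ IsClique J (Y.erase m) := by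
    rw [isClique_iff, isClique_iff]
    constructor
    · intro H w hw
      rw [Finset.mem_erase] at hw
      by_cases hwq : w = q
      · rwa [hwq]
      · exact (key w hwq hw.1).1 (H w (Finset.mem_erase.2 ⟨hwq, hw.2⟩))
    · intro H w hw
      rw [Finset.mem_erase] at hw
      by_cases hwm : w = m
      · rwa [hwm]
      · exact (key w hw.1 hwm).2 (H w (Finset.mem_erase.2 ⟨hwm, hw.2⟩))
  have hcard : (topClique J (Y.erase q)).card = (topClique J (Y.erase m)).card := by
    rw [← Finset.card_erase_add_one hmt, ← Finset.card_erase_add_one hq]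
    congr 2
    ext w
    rw [Finset.mem_erase, Finset.mem_erase]
    constructor
    · rintro ⟨hwm, hw⟩
      have hwq : w ≠ q := Finset.ne_of_mem_erase (mem_topClique.1 hw).1
      exact ⟨hwq, (key w hwq hwm).1 hw⟩
    · rintro ⟨hwq, hw⟩
      have hwm : w ≠ m := Finset.ne_of_mem_erase (mem_topClique.1 hw).1
      exact ⟨hwm, (key w hwq hwm).2 hw⟩
  rw [InL, InL, InM, InM, hcl, hcard]
  exact ⟨Iff.rfl, Iff.rfl⟩

theorem topClique_erase_left (h : Pivot J Y q m) (hx : ∀ x ∈ topClique J (Y.erase q), ¬ x < q) :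
    topClique J (Y.erase q) = topClique J Y := by
  ext w
  rw [h.mem_topClique_iff]
  constructor
  · intro hw
    have hw' := Finset.mem_erase.1 (mem_topClique.1 hw).1
    exact ⟨hw'.2, (h.le_or_ge w hw'.2).resolve_left fun hle =>
      hx w hw (lt_of_le_of_ne hle hw'.1)⟩
  · rintro ⟨hw, hmw⟩
    exact topClique_upward h.right_mem_topClique_erase
      (Finset.mem_erase.2 ⟨(h.lt.trans_le hmw).ne', hw⟩) hmw

theorem even_card_erase_right (h : Pivot J Y q m) (hq : q ∉ topClique J (Y.erase m)) :
    Even (topClique J (Y.erase m)).card ↔ Odd (topClique J Y).card := by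
  have : topClique J (Y.erase m) = (topClique J Y).erase m := by
    ext w
    rw [Finset.mem_erase, h.mem_topClique_iff]
    constructor
    · intro hw
      have hw' := Finset.mem_erase.1 (mem_topClique.1 hw).1
      refine ⟨hw'.1, hw'.2, (h.le_or_ge w hw'.2).resolve_left fun hle => hq ?_⟩
      exact topClique_upward hw (Finset.mem_erase.2 ⟨h.lt.ne, h.left_mem⟩) hle
    · rintro ⟨hwm, hw, hmw⟩
      exact mem_topClique.2 ⟨Finset.mem_erase.2 ⟨hwm, hw⟩, fun a ha b hb hwa =>
        h.clique a (Finset.mem_of_mem_erase ha) b (Finset.mem_of_mem_erase hb) (hmw.trans hwa)⟩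
  rw [this, ← Finset.card_erase_add_one h.right_mem_topClique, Nat.odd_add_one,
    Nat.not_odd_iff_even]

theorem not_isClique_erase_right (h : Pivot J Y q m) (hq : q ∉ topClique J (Y.erase m)) :
    ¬ IsClique J (Y.erase m) :=
  fun hc => hq (isClique_iff.1 hc q (Finset.mem_erase.2 ⟨h.lt.ne, h.left_mem⟩))

theorem isClique_erase_right (hq : q ∈ topClique J (Y.erase m))
    (hx : ∀ x ∈ topClique J (Y.erase q), ¬ x < q) (hc : IsClique J (Y.erase q)) :
    IsClique J (Y.erase m) := by
  rw [isClique_iff] at hc ⊢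
  intro w hw
  refine topClique_upward hq hw (not_lt.1 fun hwq => ?_)
  exact hx w (hc w (Finset.mem_erase.2 ⟨hwq.ne, Finset.mem_of_mem_erase hw⟩)) hwq

/-- If `q` does not join the top clique after `m` is deleted, that clique just loses `m` and becomes
even, so the right twin is in $L$. If `q` joins but nothing below `q` joins in the left twin, the
left twin keeps an odd top clique and can lie in $M$ only as a clique, which makes the right twin a
clique. Otherwise the twins behave identically. -/
theorem twin_of_odd (hJ : Realizable 2 J) (h : Pivot J Y q m) (ho : Odd (topClique J Y).card) :
    (InL J (Y.erase q) → InL J (Y.erase m)) ∧ (InM J (Y.erase q) → InM J (Y.erase m)) := by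
  by_cases hq : q ∈ topClique J (Y.erase m)
  · by_cases hx : ∃ x ∈ topClique J (Y.erase q), x < q
    · obtain ⟨x, hx, hxq⟩ := hx
      have := h.inL_inM_twin hJ hq hx hxq
      exact ⟨this.1.1, this.2.1⟩
    · push Not at hx
      have hx' : ∀ x ∈ topClique J (Y.erase q), ¬ x < q := fun x h' => not_lt.2 (hx x h')
      have ht := h.topClique_erase_left hx'
      have hne : ¬ Even (topClique J (Y.erase q)).card := by rwa [ht, Nat.not_even_iff_odd]
      exact ⟨fun hL => absurd hL.2 hne, fun hM =>
        Or.inl (isClique_erase_right hq hx' (hM.resolve_right hne))⟩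
  · have : InL J (Y.erase m) := ⟨h.not_isClique_erase_right hq, (h.even_card_erase_right hq).2 ho⟩
    exact ⟨fun _ => this, fun _ => this.inM⟩

/-- The same three cases as for odd parity, with the roles of the twins exchanged. -/
theorem twin_of_even (hJ : Realizable 2 J) (h : Pivot J Y q m)
    (he : Even (topClique J Y).card) :
    (InL J (Y.erase m) → InL J (Y.erase q)) ∧ (InM J (Y.erase m) → InM J (Y.erase q)) := by
  have hno : q ∉ topClique J (Y.erase m) → ¬ InM J (Y.erase m) := by
    rintro hq (hc | hc)
    · exact h.not_isClique_erase_right hq hc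
    · exact Nat.not_even_iff_odd.2 ((h.even_card_erase_right hq).1 hc) he
  by_cases hq : q ∈ topClique J (Y.erase m)
  · by_cases hx : ∃ x ∈ topClique J (Y.erase q), x < q
    · obtain ⟨x, hx, hxq⟩ := hx
      have := h.inL_inM_twin hJ hq hx hxq
      exact ⟨this.1.2, this.2.2⟩
    · push Not at hx
      have hx' : ∀ x ∈ topClique J (Y.erase q), ¬ x < q := fun x h' => not_lt.2 (hx x h')
      have he' : Even (topClique J (Y.erase q)).card := by rwa [h.topClique_erase_left hx']
      exact ⟨fun hL => ⟨fun hc => hL.1 (isClique_erase_right hq hx' hc), he'⟩,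
        fun _ => Or.inr he'⟩
  · exact ⟨fun hL => absurd hL.inM (hno hq), fun hM => absurd hM (hno hq)⟩

/-- A family between `L` and `M` meets the packet of `Y` in an initial or a final segment if it
respects the twins at the pivot. -/
theorem lower_or_upper (h : Pivot J Y q m) {V : Family n}
    (hL : ∀ z ∈ Y, InL J (Y.erase z) → Y.erase z ∈ V)
    (hM : ∀ z ∈ Y, Y.erase z ∈ V → InM J (Y.erase z))
    (hodd : Odd (topClique J Y).card → Y.erase q ∈ V → Y.erase m ∈ V)
    (heven : Even (topClique J Y).card → Y.erase m ∈ V → Y.erase q ∈ V) :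
    Lower Y V ∨ Upper Y V := by
  have hcases : ∀ z ∈ Y, z < q ∨ z = q ∨ z = m ∨ m < z := by
    intro z hz
    rcases h.le_or_ge z hz with h' | h'
    · rcases h'.eq_or_lt with h' | h' <;> simp [h']
    · rcases h'.eq_or_lt with h' | h' <;> simp [h']
  have hlt := h.lt
  rcases Nat.even_or_odd (topClique J Y).card with he | ho
  · right
    have hne := Nat.not_odd_iff_even.2 he
    have h1 : ∀ z ∈ Y, z < q → Y.erase z ∈ V := fun z hz hzq =>
      hL z hz ((h.inL_erase_of_lt hzq).2 he)
    have h2 : ∀ z ∈ Y, m < z → Y.erase z ∉ V := fun z hz hzq hzV =>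
      hne ((h.inM_erase_of_gt hz hzq).1 (hM z hz hzV))
    intro a ha b hb hba haV
    rcases hcases b hb with hbq | rfl | rfl | hmb
    · exact h1 b hb hbq
    · rcases hcases a ha with h' | h' | rfl | h'
      · omega
      · omega
      · exact heven he haV
      · exact absurd haV (h2 a ha h')
    · exact absurd haV (h2 a ha hba)
    · exact absurd haV (h2 a ha (hmb.trans hba))
  · left
    have hne := Nat.not_even_iff_odd.2 ho
    have h1 : ∀ z ∈ Y, m < z → Y.erase z ∈ V := fun z hz hmz =>
      hL z hz ((h.inL_erase_of_gt hz hmz).2 ho)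
    have h2 : ∀ z ∈ Y, z < q → Y.erase z ∉ V := fun z hz hzq hzV =>
      hne ((h.inM_erase_of_lt hzq).1 (hM z hz hzV))
    intro a ha b hb hba hbV
    rcases hcases a ha with haq | rfl | rfl | hma
    · exact absurd hbV (h2 b hb (hba.trans haq))
    · exact absurd hbV (h2 b hb hba)
    · rcases hcases b hb with h' | rfl | h' | h'
      · exact absurd hbV (h2 b hb h')
      · exact hodd ho hbV
      · omega
      · omega
    · exact h1 a ha hma

/-- A family between `L` and `M` that meets the packet of `Y` in an initial or a final segment
respects the twins at the pivot. -/
theorem twin_of_lower_or_upper (h : Pivot J Y q m) (hY : 3 ≤ Y.card) {V : Family n}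
    (hL : ∀ z ∈ Y, InL J (Y.erase z) → Y.erase z ∈ V)
    (hM : ∀ z ∈ Y, Y.erase z ∈ V → InM J (Y.erase z)) (hV : Lower Y V ∨ Upper Y V) :
    (Odd (topClique J Y).card → Y.erase q ∈ V → Y.erase m ∈ V) ∧
      (Even (topClique J Y).card → Y.erase m ∈ V → Y.erase q ∈ V) := by
  -- A third element is needed: its face has prescribed membership and so decides whether the packet
  -- is cut as a prefix or as a suffix.
  obtain ⟨z, hz, hzq, hzm⟩ : ∃ z ∈ Y, z ≠ q ∧ z ≠ m := by
    by_contra hcon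
    push Not at hcon
    have : Y ⊆ {q, m} := fun z hz => by
      by_cases hzq : z = q
      · simp [hzq]
      · simp [hcon z hz hzq]
    have := (Finset.card_le_card this).trans Finset.card_le_two
    omega
  have hcase : z < q ∨ m < z := (h.le_or_ge z hz).imp (fun h' => lt_of_le_of_ne h' hzq)
    (fun h' => lt_of_le_of_ne h' hzm.symm)
  constructor
  · intro ho hqV
    rcases hV with hV | hV
    · exact hV m h.right_mem q h.left_mem h.lt hqV
    · rcases hcase with h' | h'
      · exact absurd ((h.inM_erase_of_lt h').1 (hM z hz (hV q h.left_mem z hz h' hqV)))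
          (Nat.not_even_iff_odd.2 ho)
      · exact hV z hz m h.right_mem h' (hL z hz ((h.inL_erase_of_gt hz h').2 ho))
  · intro he hmV
    rcases hV with hV | hV
    · rcases hcase with h' | h'
      · exact hV q h.left_mem z hz h' (hL z hz ((h.inL_erase_of_lt h').2 he))
      · exact absurd ((h.inM_erase_of_gt hz h').1 (hM z hz (hV z hz m h.right_mem h' hmV)))
          (Nat.not_odd_iff_even.2 he)
    · exact hV m h.right_mem q h.left_mem h.lt hmV

end Pivot

end Cliques

/-! ### The closed form of $L^i$ and $M^i$, and the realizability claim. -/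

section LM

variable {n : ℕ} {J : Family n} {X Y : Finset (Fin n)} {q m : Fin n}

theorem M_subset_C (hJ : Realizable 2 J) (i : ℕ) : M J i ⊆ C n i := by
  match i with
  | 0 => simp [M, LM]
  | 1 => simp [M, LM]
  | 2 => exact (realizable_iff.1 hJ).1
  | i + 3 =>
    intro X hX
    rcases Finset.mem_union.1 hX with h | h
    · exact mem_C.2 (mem_suf.1 h).1
    · exact mem_C.2 (mem_full.1 h).1

/-- With at least three elements in `X`, every pair survives the deletion of some other element. -/
theorem IsClique.of_erase {k : ℕ} (hX : X.card = k + 1) (hk : 2 ≤ k)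
    (h : ∀ a ∈ X, IsClique J (X.erase a)) : IsClique J X := by
  intro a ha b hb hab
  obtain ⟨c, hc, hca, hcb⟩ : ∃ c ∈ X, c ≠ a ∧ c ≠ b := by
    by_contra hcon
    push Not at hcon
    have : X ⊆ {a, b} := fun z hz => by
      by_cases hza : z = a
      · simp [hza]
      · simp [hcon z hz hza]
    have := (Finset.card_le_card this).trans Finset.card_le_two
    omega
  exact h c hc a (Finset.mem_erase.2 ⟨hca.symm, ha⟩) b (Finset.mem_erase.2 ⟨hcb.symm, hb⟩) hab

theorem consistent_of_mem_iff_inM (hJ : Realizable 2 J) {k : ℕ} {V : Family n}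
    (hV : ∀ X : Finset (Fin n), X.card = k → (X ∈ V ↔ InM J X)) : Consistent k V := by
  intro Y hY
  have hc : ∀ z ∈ Y, (Y.erase z).card = k := fun z hz => by
    rw [Finset.card_erase_of_mem hz, hY]; rfl
  by_cases hcl : IsClique J Y
  · exact Or.inl fun a ha _ _ _ _ =>
      (hV _ (hc a ha)).2 (Or.inl (hcl.mono (Finset.erase_subset _ _)))
  · obtain ⟨q, m, h⟩ := exists_pivot hJ hcl
    have hq := hV _ (hc q h.left_mem)
    have hm := hV _ (hc m h.right_mem)
    refine h.lower_or_upper (fun z hz hL => (hV _ (hc z hz)).2 hL.inM)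
      (fun z hz => (hV _ (hc z hz)).1) ?_ ?_
    · rw [hq, hm]
      exact fun ho => (h.twin_of_odd hJ ho).2
    · rw [hq, hm]
      exact fun he => (h.twin_of_even hJ he).2

/-- A clique has a full packet. For a non-clique the parity fixes the side on which faces lie in
$M$: odd parity rules out any suffix-type pair, the twins included, and even parity supplies an
absent face beyond the pivot and a present one at or before `q`. -/
theorem mem_suf_iff_inL (hJ : Realizable 2 J) {k : ℕ} {V : Family n}
    (hV : ∀ X : Finset (Fin n), X.card = k → (X ∈ V ↔ InM J X)) (hX : X.card = k + 1) :
    X ∈ suf k V ↔ InL J X := by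
  rw [(consistent_of_mem_iff_inM hJ hV).mem_suf_iff, and_iff_right hX]
  have hc : ∀ z ∈ X, (X.erase z).card = k := fun z hz => by
    rw [Finset.card_erase_of_mem hz, hX]; rfl
  by_cases hcl : IsClique J X
  · constructor
    · rintro ⟨a, ha, -, -, -, haV, -⟩
      exact absurd ((hV _ (hc a ha)).2 (Or.inl (hcl.mono (Finset.erase_subset _ _)))) haV
    · exact fun h => absurd hcl h.1
  obtain ⟨q, m, h⟩ := exists_pivot hJ hcl
  rw [h.inL_iff]
  constructor
  · rintro ⟨a, ha, b, hb, hba, haV, hbV⟩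
    rw [hV _ (hc a ha)] at haV
    rw [hV _ (hc b hb)] at hbV
    by_contra he
    have ho := Nat.not_even_iff_odd.1 he
    have ham : a ≤ m := by
      by_contra h'
      exact haV ((h.inM_erase_of_gt ha (not_le.1 h')).2 ho)
    have hqb : q ≤ b := by
      by_contra h'
      exact he ((h.inM_erase_of_lt (not_le.1 h')).1 hbV)
    have hma : m ≤ a := (h.le_or_ge a ha).resolve_left (not_le.2 (hqb.trans_lt hba))
    have hbq : b ≤ q := (h.le_or_ge b hb).resolve_right (not_le.2 (hba.trans_le ham))
    obtain rfl := le_antisymm ham hma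
    obtain rfl := le_antisymm hbq hqb
    exact haV ((h.twin_of_odd hJ ho).2 hbV)
  · intro he
    obtain ⟨d, hd, hmd⟩ := h.exists_gt he
    have hdV : X.erase d ∉ V := by
      rw [hV _ (hc d hd), h.inM_erase_of_gt hd hmd]
      exact Nat.not_odd_iff_even.2 he
    by_cases hz : ∃ z ∈ X, z < q
    · obtain ⟨z, hz, hzq⟩ := hz
      exact ⟨d, hd, z, hz, hzq.trans (h.lt.trans hmd), hdV,
        (hV _ (hc z hz)).2 ((h.inM_erase_of_lt hzq).2 he)⟩
    · push Not at hz
      -- If `q` is the minimum of `X`, deleting it leaves exactly the elements from `m` on, which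
      -- form a clique.
      refine ⟨d, hd, q, h.left_mem, h.lt.trans hmd, hdV, (hV _ (hc q h.left_mem)).2 (Or.inl ?_)⟩
      intro a ha b hb hab
      rw [Finset.mem_erase] at ha hb
      exact h.clique a ha.2 b hb.2 ((h.le_or_ge a ha.2).resolve_left fun h' =>
        ha.1 (le_antisymm h' (hz a ha.2))) hab

/-- The suffix part of the recursion is handled by `mem_suf_iff_inL`. The full part sees only
$M\setminus L$, which consists of cliques, so it yields exactly the larger cliques. -/
theorem mem_LM_iff (hJ : Realizable 2 J) (i : ℕ) : ∀ X : Finset (Fin n), X.card = i + 2 →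
    (X ∈ L J (i + 2) ↔ InL J X) ∧ (X ∈ M J (i + 2) ↔ InM J X) := by
  induction i with
  | zero =>
    intro X hX
    obtain ⟨a, b, hab, rfl⟩ : ∃ a b, a < b ∧ X = {a, b} := by
      obtain ⟨a, b, hab, rfl⟩ := Finset.card_eq_two.1 hX
      rcases lt_or_gt_of_ne hab with h | h
      · exact ⟨a, b, h, rfl⟩
      · exact ⟨b, a, h, Finset.pair_comm _ _⟩
    -- A non-clique with even top clique contains `q`, `m` and a further element beyond `m`, hence
    -- is never a pair; this matches $L^2=\emptyset$.
    have hL : ¬ InL J {a, b} := by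
      rintro ⟨hcl, he⟩
      obtain ⟨q, m, h⟩ := exists_pivot hJ hcl
      obtain ⟨z, hz, hmz⟩ := h.exists_gt he
      have := Finset.card_le_card (show {q, m, z} ⊆ ({a, b} : Finset (Fin n)) by
        intro x hx
        simp only [Finset.mem_insert, Finset.mem_singleton] at hx
        rcases hx with rfl | rfl | rfl
        exacts [h.left_mem, h.right_mem, hz])
      rw [hX, Finset.card_eq_three.2 ⟨q, m, z, h.lt.ne, (h.lt.trans hmz).ne, hmz.ne, rfl⟩] at this
      omega
    have hcl : IsClique J {a, b} ↔ {a, b} ∈ J := by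
      constructor
      · exact fun h => h a (by simp) b (by simp) hab
      · intro h c hc d hd hcd
        simp only [Finset.mem_insert, Finset.mem_singleton] at hc hd
        rcases hc with rfl | rfl <;> rcases hd with rfl | rfl
        · exact absurd hcd (lt_irrefl _)
        · exact h
        · exact absurd hcd hab.le.not_gt
        · exact absurd hcd (lt_irrefl _)
    constructor
    · exact iff_of_false (Finset.notMem_empty _) hL
    · change {a, b} ∈ J ↔ _
      rw [← hcl]
      exact ⟨Or.inl, fun h => by_contra fun h' => hL (h.inL h')⟩
  | succ i ih =>
    intro X hX
    have h1 : X ∈ suf (i + 2) (M J (i + 2)) ↔ InL J X :=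
      mem_suf_iff_inL hJ (fun X hX => (ih X hX).2) hX
    refine ⟨h1, ?_⟩
    change X ∈ suf (i + 2) (M J (i + 2)) ∪ full (i + 2) (M J (i + 2) \ L J (i + 2)) ↔ _
    rw [Finset.mem_union, h1, mem_full, and_iff_right hX]
    have hc : ∀ z ∈ X, (X.erase z).card = i + 2 := fun z hz => by
      rw [Finset.card_erase_of_mem hz, hX]; rfl
    have h2 : (∀ a ∈ X, X.erase a ∈ M J (i + 2) \ L J (i + 2)) ↔ IsClique J X := by
      constructor
      · refine fun h => IsClique.of_erase hX (by omega) fun a ha => ?_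
        have := Finset.mem_sdiff.1 (h a ha)
        rw [(ih _ (hc a ha)).1, (ih _ (hc a ha)).2] at this
        exact by_contra fun h' => this.2 (this.1.inL h')
      · intro h a ha
        have := h.mono (Finset.erase_subset a X)
        rw [Finset.mem_sdiff, (ih _ (hc a ha)).1, (ih _ (hc a ha)).2]
        exact ⟨Or.inl this, fun h' => h'.1 this⟩
    rw [h2]
    constructor
    · rintro (h | h)
      · exact h.inM
      · exact Or.inl h
    · intro h
      by_cases hcl : IsClique J X
      · exact Or.inr hcl
      · exact Or.inl (h.inL hcl)

theorem mem_L_iff (hJ : Realizable 2 J) {k : ℕ} (hk : 2 ≤ k) (hX : X.card = k) :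
    X ∈ L J k ↔ InL J X := by
  obtain ⟨i, rfl⟩ := Nat.exists_eq_add_of_le' hk
  exact (mem_LM_iff hJ i X hX).1

theorem mem_M_iff (hJ : Realizable 2 J) {k : ℕ} (hk : 2 ≤ k) (hX : X.card = k) :
    X ∈ M J k ↔ InM J X := by
  obtain ⟨i, rfl⟩ := Nat.exists_eq_add_of_le' hk
  exact (mem_LM_iff hJ i X hX).2

theorem M_consistent (hJ : Realizable 2 J) {k : ℕ} (hk : 2 ≤ k) : Consistent k (M J k) :=
  consistent_of_mem_iff_inM hJ fun _ hX => mem_M_iff hJ hk hX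

theorem mem_suf_M_iff (hJ : Realizable 2 J) {k : ℕ} (hk : 2 ≤ k) (hX : X.card = k + 1) :
    X ∈ suf k (M J k) ↔ InL J X :=
  mem_suf_iff_inL hJ (fun _ hX => mem_M_iff hJ hk hX) hX

/-- The twin condition is inherited by the set of suffix packets. -/
theorem suf_twin {k : ℕ} (hk : 2 ≤ k) {K : Family n} (hK : Consistent k K)
    (hL : ∀ X : Finset (Fin n), X.card = k → InL J X → X ∈ K)
    (hM : ∀ X : Finset (Fin n), X.card = k → X ∈ K → InM J X)
    (hY : Y.card = k + 2) (h : Pivot J Y q m) :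
    (Odd (topClique J Y).card → Y.erase q ∈ suf k K → Y.erase m ∈ suf k K) ∧
      (Even (topClique J Y).card → Y.erase m ∈ suf k K → Y.erase q ∈ suf k K) := by
  have hc : ∀ z ∈ Y, (Y.erase z).card = k + 1 := fun z hz => by
    rw [Finset.card_erase_of_mem hz, hY]; rfl
  -- Each face `Y.erase z` has the same pivot, so `K` already obeys the twin implication there, with
  -- the parity of that face.
  have htwin : ∀ z ∈ Y, z ≠ q → z ≠ m →
      (Odd (topClique J (Y.erase z)).card →
        (Y.erase q).erase z ∈ K → (Y.erase m).erase z ∈ K) ∧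
      (Even (topClique J (Y.erase z)).card →
        (Y.erase m).erase z ∈ K → (Y.erase q).erase z ∈ K) := by
    intro z hz hzq hzm
    have hc' : ∀ w ∈ Y.erase z, ((Y.erase z).erase w).card = k := fun w hw => by
      rw [Finset.card_erase_of_mem hw, hc z hz]; rfl
    rw [Finset.erase_right_comm (a := q), Finset.erase_right_comm (a := m)]
    exact (h.erase hzq hzm).twin_of_lower_or_upper (by rw [hc z hz]; omega)
      (fun w hw => hL _ (hc' w hw)) (fun w hw => hM _ (hc' w hw)) (hK _ (hc z hz))
  have hlt := h.lt
  have hne : Y.Nonempty := ⟨q, h.left_mem⟩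
  obtain ⟨d, hd, hdmax⟩ : ∃ d ∈ Y, ∀ y ∈ Y, y ≤ d := ⟨_, Y.max'_mem hne, fun y hy => Y.le_max' y hy⟩
  obtain ⟨c, hcY, hcmin⟩ : ∃ c ∈ Y, ∀ y ∈ Y, c ≤ y := ⟨_, Y.min'_mem hne, fun y hy => Y.min'_le y hy⟩
  have hmd := hdmax m h.right_mem
  have hcq := hcmin q h.left_mem
  have hcomm : (Y.erase m).erase q = (Y.erase q).erase m := Finset.erase_right_comm
  -- Compare the first faces of the two twins. Either `m` is the maximum of `Y` and both faces equal
  -- $Y\setminus\{q,m\}$, or both delete the same `d > m` and are themselves twins in `Y.erase d`.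
  -- The minimum is treated symmetrically.
  obtain ⟨d', hd', hdmax', hdd⟩ : ∃ d' ∈ Y.erase m, (∀ y ∈ Y.erase m, y ≤ d') ∧
      ((Y.erase m).erase d' = (Y.erase q).erase d ∨ (m < d ∧ d' = d)) := by
    rcases hmd.eq_or_lt with hmd | hmd
    · refine ⟨q, Finset.mem_erase.2 ⟨hlt.ne, h.left_mem⟩, fun y hy => ?_, Or.inl ?_⟩
      · rw [Finset.mem_erase] at hy
        exact (h.le_or_ge y hy.2).resolve_right fun h' =>
          hy.1 (le_antisymm ((hdmax y hy.2).trans hmd.ge) h')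
      · rw [← hmd]; exact hcomm
    · exact ⟨d, Finset.mem_erase.2 ⟨hmd.ne', hd⟩,
        fun y hy => hdmax y (Finset.mem_of_mem_erase hy), Or.inr ⟨hmd, rfl⟩⟩
  obtain ⟨c', hc', hcmin', hcc⟩ : ∃ c' ∈ Y.erase q, (∀ y ∈ Y.erase q, c' ≤ y) ∧
      ((Y.erase q).erase c' = (Y.erase m).erase c ∨ (c < q ∧ c' = c)) := by
    rcases hcq.eq_or_lt with hcq | hcq
    · refine ⟨m, Finset.mem_erase.2 ⟨hlt.ne', h.right_mem⟩, fun y hy => ?_, Or.inl ?_⟩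
      · rw [Finset.mem_erase] at hy
        exact (h.le_or_ge y hy.2).resolve_left fun h' =>
          hy.1 (le_antisymm h' (hcq.ge.trans (hcmin y hy.2)))
      · rw [hcq]; exact hcomm.symm
    · exact ⟨c, Finset.mem_erase.2 ⟨hcq.ne, hcY⟩,
        fun y hy => hcmin y (Finset.mem_of_mem_erase hy), Or.inr ⟨hcq, rfl⟩⟩
  rw [hK.mem_suf_iff_extremes (hc q h.left_mem) (Finset.mem_erase.2 ⟨(hlt.trans_le hmd).ne', hd⟩)
      (fun y hy => hdmax y (Finset.mem_of_mem_erase hy)) hc' hcmin',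
    hK.mem_suf_iff_extremes (hc m h.right_mem) hd' hdmax'
      (Finset.mem_erase.2 ⟨(hcq.trans_lt hlt).ne, hcY⟩)
      (fun y hy => hcmin y (Finset.mem_of_mem_erase hy))]
  -- The parity changes at the maximum, where absence is tested, but not at the minimum, where
  -- presence is tested. The contrapositive at the maximum compensates for the change, so both tests
  -- transfer in the same direction.
  have hdpar : m < d → (Even (topClique J (Y.erase d)).card ↔ Odd (topClique J Y).card) :=
    h.even_card_erase_of_gt hd
  have hcpar : c < q → (Even (topClique J (Y.erase c)).card ↔ Even (topClique J Y).card) :=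
    h.even_card_erase_of_lt
  constructor
  · rintro ho ⟨h1, h2⟩
    constructor
    · rcases hdd with e | ⟨hmd, rfl⟩
      · rwa [e]
      · exact fun h' => h1 ((htwin d' hd (hlt.trans hmd).ne' hmd.ne').2 ((hdpar hmd).2 ho) h')
    · rcases hcc with e | ⟨hcq, rfl⟩
      · rwa [← e]
      · refine (htwin c' hcY hcq.ne (hcq.trans hlt).ne).1 ?_ h2
        rwa [← Nat.not_even_iff_odd, hcpar hcq, Nat.not_even_iff_odd]
  · rintro he ⟨h1, h2⟩
    constructor
    · rcases hdd with e | ⟨hmd, rfl⟩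
      · rwa [← e]
      · refine fun h' => h1 ((htwin d' hd (hlt.trans hmd).ne' hmd.ne').1 ?_ h')
        rwa [← Nat.not_even_iff_odd, hdpar hmd, Nat.not_odd_iff_even]
    · rcases hcc with e | ⟨hcq, rfl⟩
      · rwa [e]
      · exact (htwin c' hcY hcq.ne (hcq.trans hlt).ne).2 ((hcpar hcq).2 he) h2

theorem realizable_suf_union_suf (hJ : Realizable 2 J) {k : ℕ} (hk : 2 ≤ k) {K : Family n}
    (hK : Realizable k K) (hLK : L J k ⊆ K) (hKM : K ⊆ M J k) :
    Realizable (k + 1) (suf k K ∪ suf k (M J k)) := by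
  have hKc := (realizable_iff.1 hK).2
  have hL : ∀ X : Finset (Fin n), X.card = k → InL J X → X ∈ K := fun X hX h =>
    hLK ((mem_L_iff hJ hk hX).2 h)
  have hM : ∀ X : Finset (Fin n), X.card = k → X ∈ K → InM J X := fun X hX h =>
    (mem_M_iff hJ hk hX).1 (hKM h)
  refine realizable_iff.2 ⟨fun X hX => ?_, fun Y hY => ?_⟩
  · rcases Finset.mem_union.1 hX with h | h <;> exact mem_C.2 (mem_suf.1 h).1
  have hc : ∀ z ∈ Y, (Y.erase z).card = k + 1 := fun z hz => by
    rw [Finset.card_erase_of_mem hz, hY]; rfl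
  have hmem : ∀ z ∈ Y, (Y.erase z ∈ suf k K ∪ suf k (M J k) ↔
      Y.erase z ∈ suf k K ∨ InL J (Y.erase z)) := fun z hz => by
    rw [Finset.mem_union, mem_suf_M_iff hJ hk (hc z hz)]
  by_cases hcl : IsClique J Y
  · have hiff : ∀ z ∈ Y, (Y.erase z ∈ suf k K ∪ suf k (M J k) ↔ Y.erase z ∈ suf k K) := by
      intro z hz
      rw [hmem z hz]
      exact or_iff_left fun h => h.1 (hcl.mono (Finset.erase_subset _ _))
    refine (hKc.suf Y hY).imp ?_ ?_
    all_goals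
      intro H a ha b hb hba hm
      rw [hiff _ (by assumption)] at hm ⊢
      exact H a ha b hb hba hm
  obtain ⟨q, m, h⟩ := exists_pivot hJ hcl
  -- For an odd non-clique all faces beyond the pivot are in `K` and none before it, so a
  -- suffix-type pair could occur only at the twins, where the twin implication excludes it.
  have hsM : ∀ X : Finset (Fin n), X.card = k + 1 → X ∈ suf k K → InM J X := by
    intro X hX hs
    by_cases hXc : IsClique J X
    · exact Or.inl hXc
    obtain ⟨q, m, h⟩ := exists_pivot hJ hXc
    have hcX : ∀ z ∈ X, (X.erase z).card = k := fun z hz => by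
      rw [Finset.card_erase_of_mem hz, hX]; rfl
    rw [h.inM_iff]
    by_contra he
    have ho := Nat.not_even_iff_odd.1 he
    obtain ⟨-, a, ha, b, hb, hba, haK, hbK⟩ := hKc.mem_suf_iff.1 hs
    have htw := (h.twin_of_lower_or_upper (by omega) (fun z hz => hL _ (hcX z hz))
      (fun z hz => hM _ (hcX z hz)) (hKc X hX)).1 ho
    have ham : a ≤ m := not_lt.1 fun h' =>
      haK (hL _ (hcX a ha) ((h.inL_erase_of_gt ha h').2 ho))
    have hqb : q ≤ b := not_lt.1 fun h' =>
      he ((h.inM_erase_of_lt h').1 (hM _ (hcX b hb) hbK))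
    have hma : m ≤ a := (h.le_or_ge a ha).resolve_left (not_le.2 (hqb.trans_lt hba))
    have hbq : b ≤ q := (h.le_or_ge b hb).resolve_right (not_le.2 (hba.trans_le ham))
    obtain rfl := le_antisymm ham hma
    obtain rfl := le_antisymm hbq hqb
    exact haK (htw hbK)
  have htw := suf_twin hk hKc hL hM hY h
  refine h.lower_or_upper (fun z hz hz' => (hmem z hz).2 (Or.inr hz')) (fun z hz hz' => ?_)
    (fun ho => ?_) (fun he => ?_)
  · rcases (hmem z hz).1 hz' with h' | h'
    · exact hsM _ (hc z hz) h'
    · exact h'.inM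
  · rw [hmem q h.left_mem, hmem m h.right_mem]
    exact Or.imp (htw.1 ho) (h.twin_of_odd hJ ho).1
  · rw [hmem q h.left_mem, hmem m h.right_mem]
    exact Or.imp (htw.2 he) (h.twin_of_even hJ he).1

end LM

/-! ### Enlarging a consistent family by one clique. -/

section Extension

variable {n : ℕ} {J : Family n}

/-- The total order on the ground set whose inversion set is `J`. -/
def Prec (J : Family n) (a b : Fin n) : Prop :=
  (a < b ∧ {a, b} ∉ J) ∨ (b < a ∧ {b, a} ∈ J)

theorem Prec.trans (hJ : Realizable 2 J) {a b c : Fin n} (hab : Prec J a b) (hbc : Prec J b c) :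
    Prec J a c := by
  rcases hab with ⟨hab, h1⟩ | ⟨hab, h1⟩ <;> rcases hbc with ⟨hbc, h2⟩ | ⟨hbc, h2⟩
  · exact Or.inl ⟨hab.trans hbc, fun h => ((consistent_triple hJ hab hbc).2 h).elim h1 h2⟩
  · rcases lt_trichotomy a c with h | rfl | h
    · exact Or.inl ⟨h, fun h' => h1 ((consistent_triple hJ h hbc).1 h' h2)⟩
    · exact absurd h2 h1
    · exact Or.inr ⟨h, ((consistent_triple hJ h hab).2 h2).resolve_right h1⟩
  · rcases lt_trichotomy a c with h | rfl | h
    · exact Or.inl ⟨h, fun h' => h2 ((consistent_triple hJ hab h).1 h1 h')⟩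
    · exact absurd h1 h2
    · exact Or.inr ⟨h, ((consistent_triple hJ hbc h).2 h1).resolve_left h2⟩
  · exact Or.inr ⟨hbc.trans hab, (consistent_triple hJ hbc hab).1 h2 h1⟩

theorem Prec.wellFounded (hJ : Realizable 2 J) : WellFounded (Prec J) := by
  have : IsTrans (Fin n) (Prec J) := ⟨fun _ _ _ => Prec.trans hJ⟩
  have : Std.Irrefl (Prec J) := ⟨fun a h => by
    rcases h with h | h <;> exact lt_irrefl _ h.1⟩
  exact Finite.wellFounded_of_trans_of_irrefl _

/-- A consistent family between `L` and `M` that misses an element of `M` can be enlarged by a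
single clique. -/
theorem exists_consistent_insert (hJ : Realizable 2 J) {k : ℕ} (hk : 2 ≤ k) {V : Family n}
    (hV : Consistent (k + 1) V)
    (hL : ∀ X : Finset (Fin n), X.card = k + 1 → InL J X → X ∈ V)
    (hM : ∀ X : Finset (Fin n), X.card = k + 1 → X ∈ V → InM J X)
    (hne : ∃ X : Finset (Fin n), X.card = k + 1 ∧ InM J X ∧ X ∉ V) :
    ∃ X : Finset (Fin n), X.card = k + 1 ∧ IsClique J X ∧ X ∉ V ∧
      Consistent (k + 1) (insert X V) := by
  classical
  obtain ⟨f, hf⟩ := hV.exists_ranks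
  -- The maxima of the missing cliques. The clique to add has its maximum `p` earliest in the
  -- permutation and, among those, its remainder `A` of largest rank for `V`.
  let S : Set (Fin n) := {p | ∃ X : Finset (Fin n), X.card = k + 1 ∧ IsClique J X ∧ X ∉ V ∧
    p ∈ X ∧ ∀ x ∈ X, x ≤ p}
  have hS : S.Nonempty := by
    obtain ⟨X, hX, hXM, hXV⟩ := hne
    have hX0 : X.Nonempty := Finset.card_pos.1 (by omega)
    exact ⟨X.max' hX0, X, hX, by_contra fun h => hXV (hL X hX (hXM.inL h)), hXV,
      X.max'_mem hX0, fun x hx => X.le_max' x hx⟩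
  obtain ⟨p, ⟨X₀, hX₀, hX₀c, hX₀V, hpX₀, hX₀p⟩, hpmin⟩ := (Prec.wellFounded hJ).has_min S hS
  let 𝒜 : Family n := Finset.univ.filter fun A => p ∉ A ∧ (∀ x ∈ A, x < p) ∧
    (insert p A).card = k + 1 ∧ IsClique J (insert p A) ∧ insert p A ∉ V
  have h𝒜 : ∀ A, A ∈ 𝒜 ↔ p ∉ A ∧ (∀ x ∈ A, x < p) ∧
    (insert p A).card = k + 1 ∧ IsClique J (insert p A) ∧ insert p A ∉ V := fun A => by simp [𝒜]
  have h𝒜ne : 𝒜.Nonempty := by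
    refine ⟨X₀.erase p, (h𝒜 _).2 ⟨Finset.notMem_erase _ _, fun x hx => ?_, ?_⟩⟩
    · rw [Finset.mem_erase] at hx
      exact lt_of_le_of_ne (hX₀p x hx.2) hx.1
    · rw [Finset.insert_erase hpX₀]
      exact ⟨hX₀, hX₀c, hX₀V⟩
  obtain ⟨A, hA, hAmax⟩ := Finset.exists_max_image 𝒜 f h𝒜ne
  obtain ⟨hpA, hAp, hXc, hXcl, hXV⟩ := (h𝒜 A).1 hA
  -- maximality of `A`, phrased for faces of a set containing `p`
  have hmax : ∀ B : Finset (Fin n), p ∈ B → (∀ x ∈ B, x ≤ p) → B.card = k + 1 → IsClique J B →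
      f A < f (B.erase p) → B ∈ V := by
    intro B hpB hBp hBc hBcl hlt
    by_contra hBV
    have := hAmax (B.erase p) ((h𝒜 _).2 ⟨Finset.notMem_erase _ _, fun x hx => by
      rw [Finset.mem_erase] at hx
      exact lt_of_le_of_ne (hBp x hx.2) hx.1, by rw [Finset.insert_erase hpB]; exact ⟨hBc, hBcl, hBV⟩⟩)
    omega
  set X := insert p A with hXdef
  have hpX : p ∈ X := Finset.mem_insert_self _ _
  have hXp : ∀ x ∈ X, x ≤ p := fun x hx => by
    rcases Finset.mem_insert.1 hx with rfl | hx
    · exact le_rfl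
    · exact (hAp x hx).le
  have hXA : X.erase p = A := Finset.erase_insert hpA
  refine ⟨X, hXc, hXcl, hXV, fun Y hY => ?_⟩
  have hc : ∀ z ∈ Y, (Y.erase z).card = k + 1 := fun z hz => by
    rw [Finset.card_erase_of_mem hz, hY]; rfl
  by_cases hXY : ∃ z ∈ Y, Y.erase z = X
  swap
  · have hiff : ∀ z ∈ Y, (Y.erase z ∈ insert X V ↔ Y.erase z ∈ V) := fun z hz => by
      rw [Finset.mem_insert]
      exact or_iff_right fun h => hXY ⟨z, hz, h⟩
    refine (hV Y hY).imp ?_ ?_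
    all_goals
      intro H a ha b hb hba hm
      rw [hiff _ (by assumption)] at hm ⊢
      exact H a ha b hb hba hm
  obtain ⟨z₀, hz₀, hz₀X⟩ := hXY
  have hpY : p ∈ Y := Finset.mem_of_mem_erase (hz₀X.symm ▸ hpX : p ∈ Y.erase z₀)
  have hz₀p : z₀ ≠ p := by
    rintro rfl
    exact Finset.notMem_erase z₀ Y (hz₀X.symm ▸ hpX)
  have hYX : ∀ y ∈ Y, y ≠ z₀ → y ∈ X := fun y hy hyz => by
    rw [← hz₀X]; exact Finset.mem_erase.2 ⟨hyz, hy⟩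
  have hinj : ∀ z ∈ Y, Y.erase z = X → z = z₀ := fun z hz h => by
    by_contra hne
    have : z ∈ Y.erase z₀ := Finset.mem_erase.2 ⟨hne, hz⟩
    rw [hz₀X, ← h] at this
    exact Finset.notMem_erase _ _ this
  have hmem : ∀ z ∈ Y, (Y.erase z ∈ insert X V ↔ z = z₀ ∨ Y.erase z ∈ V) := fun z hz => by
    rw [Finset.mem_insert]
    exact or_congr_left ⟨hinj z hz, fun h => h ▸ hz₀X⟩
  by_cases hcl : IsClique J Y
  · rcases lt_or_gt_of_ne hz₀p with hlt | hgt
    · -- `p` is the largest element of `Y`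
      have hYp : ∀ y ∈ Y, y ≤ p := fun y hy => by
        by_cases h : y = z₀
        · rw [h]; exact hlt.le
        · exact hXp y (hYX y hy h)
      have hZc : (Y.erase p).card = k + 1 := hc p hpY
      have hz₀Z : z₀ ∈ Y.erase p := Finset.mem_erase.2 ⟨hz₀p, hz₀⟩
      have hZA : (Y.erase p).erase z₀ = A := by rw [Finset.erase_right_comm, hz₀X, hXA]
      have hm : ∀ w ∈ Y, w ≠ p → f A < f ((Y.erase p).erase w) → Y.erase w ∈ V := by
        intro w hw hwp hfw
        refine hmax _ (Finset.mem_erase.2 ⟨hwp.symm, hpY⟩)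
          (fun x hx => hYp x (Finset.mem_of_mem_erase hx)) (hc w hw)
          (hcl.mono (Finset.erase_subset _ _)) ?_
        rwa [Finset.erase_right_comm]
      have hXV' : Y.erase z₀ ∉ V := hz₀X ▸ hXV
      -- Membership of `Y.erase p` decides in which direction the ranking runs along its packet. By
      -- maximality of `A`, all faces of `Y` on one side of `z₀` are therefore already in `V`.
      by_cases hZV : Y.erase p ∈ V
      · have h1 : ∀ w ∈ Y, z₀ < w → Y.erase w ∈ V := by
          intro w hw hzw
          by_cases hwp : w = p
          · rwa [hwp]
          refine hm w hw hwp ?_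
          have := (hf _ hZc z₀ hz₀Z w (Finset.mem_erase.2 ⟨hwp, hw⟩) hzw).1 hZV
          rwa [hZA] at this
        have hlow : Lower Y V := (hV Y hY).resolve_right fun H =>
          hXV' (H p hpY z₀ hz₀ hlt hZV)
        left
        intro a ha b hb hba hbW
        rw [hmem _ ha]
        rcases (hmem b hb).1 hbW with rfl | hbV
        · exact Or.inr (h1 a ha hba)
        · exact Or.inr (hlow a ha b hb hba hbV)
      · have h1 : ∀ w ∈ Y, w < z₀ → Y.erase w ∈ V := by
          intro w hw hzw
          have hwp : w ≠ p := (hzw.trans hlt).ne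
          refine hm w hw hwp ?_
          have := (hf _ hZc w (Finset.mem_erase.2 ⟨hwp, hw⟩) z₀ hz₀Z hzw).2 hZV
          rwa [hZA] at this
        right
        intro a ha b hb hba haW
        rw [hmem _ hb]
        rcases (hmem a ha).1 haW with rfl | haV
        · exact Or.inr (h1 b hb hba)
        · rcases hV Y hY with H | H
          · rcases (hYp a ha).eq_or_lt with rfl | hap
            · exact absurd haV hZV
            · exact absurd (H p hpY a ha hap haV) hZV
          · exact Or.inr (H a ha b hb hba haV)
    · -- `z₀` is the largest element of `Y`
      have hYz : ∀ y ∈ Y, y ≤ z₀ := fun y hy => by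
        by_cases h : y = z₀
        · exact h.le
        · exact (hXp y (hYX y hy h)).trans hgt.le
      have hall : ∀ w ∈ Y, Y.erase w ∈ insert X V := by
        intro w hw
        rw [hmem w hw]
        by_cases hwz : w = z₀
        · exact Or.inl hwz
        refine Or.inr (by_contra fun hwV => ?_)
        -- Since `{p, z₀} ∈ J` and `p < z₀`, the permutation puts `z₀` before `p`, so no missing
        -- clique can have maximum `z₀`.
        refine hpmin z₀ ⟨Y.erase w, hc w hw, hcl.mono (Finset.erase_subset _ _), hwV,
          Finset.mem_erase.2 ⟨fun h => hwz h.symm, hz₀⟩,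
          fun x hx => hYz x (Finset.mem_of_mem_erase hx)⟩ (Or.inr ⟨hgt, hcl p hpY z₀ hz₀ hgt⟩)
      exact Or.inl fun a ha _ _ _ _ => hall a ha
  obtain ⟨q, m, h⟩ := exists_pivot hJ hcl
  have htw := h.twin_of_lower_or_upper (by omega) (fun z hz => hL _ (hc z hz))
    (fun z hz => hM _ (hc z hz)) (hV Y hY)
  have hqY := h.left_mem
  have hmY := h.right_mem
  have hqc : Y.erase q ∉ V → InM J (Y.erase q) → IsClique J (Y.erase q) := fun h1 h2 =>
    by_contra fun h3 => h1 (hL _ (hc q hqY) (h2.inL h3))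
  have hmc : Y.erase m ∉ V → InM J (Y.erase m) → IsClique J (Y.erase m) := fun h1 h2 =>
    by_contra fun h3 => h1 (hL _ (hc m hmY) (h2.inL h3))
  -- if the largest element of `Y` lies beyond the pivot, it is `p`
  have hd : ∀ d ∈ Y, m < d → z₀ = q ∨ z₀ = m → (∀ y ∈ Y, y ≤ d) → d = p := by
    intro d hd hmd hz hdmax
    refine le_antisymm (hXp d (hYX d hd ?_)) (hdmax p hpY)
    rcases hz with rfl | rfl
    · exact (h.lt.trans hmd).ne'
    · exact hmd.ne'
  have hY0 : Y.Nonempty := ⟨q, hqY⟩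
  obtain ⟨d, hdY, hdmax⟩ : ∃ d ∈ Y, ∀ y ∈ Y, y ≤ d :=
    ⟨_, Y.max'_mem hY0, fun y hy => Y.le_max' y hy⟩
  refine h.lower_or_upper (fun z hz hz' => Finset.mem_insert_of_mem (hL _ (hc z hz) hz'))
    (fun z hz hz' => ?_) (fun ho hqW => ?_) (fun he hmW => ?_)
  · rcases (hmem z hz).1 hz' with rfl | h'
    · rw [hz₀X]; exact Or.inl hXcl
    · exact hM _ (hc z hz) h'
  · rcases (hmem q hqY).1 hqW with rfl | hqV
    swap
    · exact Finset.mem_insert_of_mem (htw.1 ho hqV)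
    by_contra hmW
    have hmV : Y.erase m ∉ V := fun h' => hmW (Finset.mem_insert_of_mem h')
    have hmcl := hmc hmV ((h.twin_of_odd hJ ho).2 (hz₀X.symm ▸ Or.inl hXcl))
    -- If `m` is the maximum of `Y`, then `p = m` and the other twin is a missing clique with
    -- maximum `q`, which precedes `m` in the permutation. Otherwise the maximum is `p`, parity puts
    -- `Y.erase p` in `V`, and the other twin has a remainder of larger rank than `A`.
    rcases (hdmax m hmY).eq_or_lt with rfl | hmd
    · have hpm : p = m := le_antisymm (hdmax p hpY) (hXp m (hYX m hmY h.lt.ne'))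
      refine hpmin q ⟨Y.erase m, hc m hmY, hmcl, hmV, Finset.mem_erase.2 ⟨h.lt.ne, hqY⟩,
        fun x hx => ?_⟩ (Or.inl ⟨hpm ▸ h.lt, hpm ▸ h.not_mem⟩)
      rw [Finset.mem_erase] at hx
      exact (h.le_or_ge x hx.2).resolve_right fun h' => hx.1 (le_antisymm (hdmax x hx.2) h')
    · obtain rfl := hd d hdY hmd (Or.inl rfl) hdmax
      have hdq := (h.lt.trans hmd).ne'
      have hZV : Y.erase d ∈ V :=
        hL _ (hc d hdY) ((h.inL_erase_of_gt hdY hmd).2 ho)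
      have hlt := (hf _ (hc d hdY) q (Finset.mem_erase.2 ⟨hdq.symm, hqY⟩) m
        (Finset.mem_erase.2 ⟨hmd.ne, hmY⟩) h.lt).1 hZV
      refine hmV (hmax _ (Finset.mem_erase.2 ⟨hmd.ne', hdY⟩)
        (fun x hx => hdmax x (Finset.mem_of_mem_erase hx)) (hc m hmY) hmcl ?_)
      rw [← hXA, ← hz₀X, Finset.erase_right_comm, Finset.erase_right_comm (a := m)]
      exact hlt
  · rcases (hmem m hmY).1 hmW with rfl | hmV
    swap
    · exact Finset.mem_insert_of_mem (htw.2 he hmV)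
    by_contra hqW
    have hqV : Y.erase q ∉ V := fun h' => hqW (Finset.mem_insert_of_mem h')
    have hqcl := hqc hqV ((h.twin_of_even hJ he).2 (hz₀X.symm ▸ Or.inl hXcl))
    have hmd : m < d := by
      obtain ⟨z, hz, hmz⟩ := h.exists_gt he
      exact hmz.trans_le (hdmax z hz)
    obtain rfl := hd d hdY hmd (Or.inr rfl) hdmax
    have hdq := (h.lt.trans hmd).ne'
    have hZV : Y.erase d ∉ V := fun h' =>
      Nat.not_odd_iff_even.2 he ((h.inM_erase_of_gt hdY hmd).1 (hM _ (hc d hdY) h'))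
    have hlt := (hf _ (hc d hdY) q (Finset.mem_erase.2 ⟨hdq.symm, hqY⟩) m
      (Finset.mem_erase.2 ⟨hmd.ne, hmY⟩) h.lt).2 hZV
    refine hqV (hmax _ (Finset.mem_erase.2 ⟨hdq, hdY⟩)
      (fun x hx => hdmax x (Finset.mem_of_mem_erase hx)) (hc q hqY) hqcl ?_)
    rw [← hXA, ← hz₀X, Finset.erase_right_comm, Finset.erase_right_comm (a := q)]
    exact hlt

end Extension

/-! ### Admissible orders and consistency of their inversion sets. -/

section Orders

variable {n k : ℕ} {J : Family n} {X : Finset (Fin n)}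

theorem pairwise_iff_idxOf {α : Type*} [DecidableEq α] {l : List α} (hl : l.Nodup)
    {R : α → α → Prop} :
    l.Pairwise R ↔ ∀ A ∈ l, ∀ B ∈ l, l.idxOf A < l.idxOf B → R A B := by
  rw [List.pairwise_iff_getElem]
  constructor
  · intro h A hA B hB hlt
    have := h _ _ (List.idxOf_lt_length_iff.2 hA) (List.idxOf_lt_length_iff.2 hB) hlt
    simpa using this
  · intro h i j hi hj hij
    refine h _ (List.getElem_mem _) _ (List.getElem_mem _) ?_
    rwa [hl.idxOf_getElem, hl.idxOf_getElem]

theorem inducesAnti_iff {l : List (Finset (Fin n))} (hl : l.Nodup) (hX : X.card = k + 1) :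
    InducesAnti k l X ↔ ∀ a ∈ X, ∀ b ∈ X, a < b → X.erase a ∈ l → X.erase b ∈ l →
      l.idxOf (X.erase a) < l.idxOf (X.erase b) := by
  rw [InducesAnti, List.pairwise_filter, pairwise_iff_idxOf hl]
  simp only [decide_eq_true_eq]
  constructor
  · intro h a ha b hb hab hal hbl
    by_contra hlt
    rcases (not_lt.1 hlt).eq_or_lt with heq | hlt
    · have := (List.idxOf_inj hbl).1 heq
      exact Finset.notMem_erase a X (this ▸ Finset.mem_erase.2 ⟨hab.ne, ha⟩)
    · have := h _ hbl _ hal hlt (erase_mem_packet hX hb) (erase_mem_packet hX ha)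
      exact absurd ((lexLT_erase ha hb).1 this) hab.not_gt
  · intro h A hAl B hBl hlt hA hB
    obtain ⟨a, ha, rfl⟩ := (mem_packet hX).1 hA
    obtain ⟨b, hb, rfl⟩ := (mem_packet hX).1 hB
    rw [lexLT_erase hb ha]
    rcases lt_trichotomy a b with h' | rfl | h'
    · exact h'
    · exact absurd hlt (lt_irrefl _)
    · exact absurd (h b hb a ha h' hBl hAl) hlt.not_gt

theorem inducesLex_iff {l : List (Finset (Fin n))} (hl : l.Nodup) (hX : X.card = k + 1) :
    InducesLex k l X ↔ ∀ a ∈ X, ∀ b ∈ X, a < b → X.erase a ∈ l → X.erase b ∈ l →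
      l.idxOf (X.erase b) < l.idxOf (X.erase a) := by
  rw [InducesLex, List.pairwise_filter, pairwise_iff_idxOf hl]
  simp only [decide_eq_true_eq]
  constructor
  · intro h a ha b hb hab hal hbl
    by_contra hlt
    rcases (not_lt.1 hlt).eq_or_lt with heq | hlt
    · have := (List.idxOf_inj hal).1 heq
      exact Finset.notMem_erase a X (this ▸ Finset.mem_erase.2 ⟨hab.ne, ha⟩)
    · have := h _ hal _ hbl hlt (erase_mem_packet hX ha) (erase_mem_packet hX hb)
      exact absurd ((lexLT_erase ha hb).1 this) hab.not_gt
  · intro h A hAl B hBl hlt hA hB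
    obtain ⟨a, ha, rfl⟩ := (mem_packet hX).1 hA
    obtain ⟨b, hb, rfl⟩ := (mem_packet hX).1 hB
    rw [lexLT_erase ha hb]
    rcases lt_trichotomy a b with h' | rfl | h'
    · exact absurd (h a ha b hb h' hAl hBl) hlt.not_gt
    · exact absurd hlt (lt_irrefl _)
    · exact h'

namespace AdmOrder

theorem mem_list (ρ : AdmOrder k J) {A : Finset (Fin n)} : A ∈ ρ.list ↔ A ∈ J := by
  rw [← List.mem_toFinset, ρ.toFinset_eq]

/-- The default position of an absent set is the length of the list, that is, after every listed
set. With it, weak monotonicity of positions also holds along partially listed packets. -/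
theorem idxOf_of_notMem (ρ : AdmOrder k J) {A : Finset (Fin n)} (hA : A ∉ J) :
    ρ.list.idxOf A = ρ.list.length :=
  List.idxOf_eq_length_iff.2 (by rwa [ρ.mem_list])

/-- Positions in the packet of an inverted set increase; absent elements count as last. -/
theorem idxOf_le_of_mem_inv (ρ : AdmOrder k J) (hX : X ∈ ρ.inv) {a b : Fin n} (ha : a ∈ X)
    (hb : b ∈ X) (hab : a < b) : ρ.list.idxOf (X.erase a) ≤ ρ.list.idxOf (X.erase b) := by
  by_cases hbJ : X.erase b ∈ J
  swap
  · rw [ρ.idxOf_of_notMem hbJ]; exact List.idxOf_le_length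
  rcases mem_inv.1 hX with ⟨hXf, hXa⟩ | hXs
  · have hX' := mem_full.1 hXf
    exact ((inducesAnti_iff ρ.nodup hX'.1).1 hXa a ha b hb hab (ρ.mem_list.2 (hX'.2 a ha))
      (ρ.mem_list.2 hbJ)).le
  · have hX' := mem_suf.1 hXs
    exact ((inducesAnti_iff ρ.nodup hX'.1).1 (ρ.anti_of_suf X hXs) a ha b hb hab
      (ρ.mem_list.2 (hX'.2.1 b hb a ha hab hbJ)) (ρ.mem_list.2 hbJ)).le

theorem inducesLex_of_notMem_inv (hJ : Consistent k J) (ρ : AdmOrder k J) (hXc : X.card = k + 1)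
    (hX : X ∉ ρ.inv) {a : Fin n} (ha : a ∈ X) (haJ : X.erase a ∈ J) :
    Lower X J ∧ InducesLex k ρ.list X := by
  rw [mem_inv, not_or, not_and] at hX
  by_cases hf : X ∈ full k J
  · exact ⟨fun b hb _ _ _ _ => (mem_full.1 hf).2 b hb,
      (ρ.lex_or_anti_of_full X hf).resolve_right (hX.1 hf)⟩
  · have hm : ∃ b ∈ X, X.erase b ∉ J := by
      by_contra h
      push Not at h
      exact hf (mem_full.2 ⟨hXc, h⟩)
    have hl : Lower X J := (hJ X hXc).resolve_right fun hu =>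
      hX.2 (mem_suf.2 ⟨hXc, hu, ⟨a, ha, haJ⟩, hm⟩)
    exact ⟨hl, ρ.lex_of_pre X (mem_pre.2 ⟨hXc, hl, ⟨a, ha, haJ⟩, hm⟩)⟩

/-- Positions in the packet of a non-inverted set decrease; absent elements count as last. -/
theorem idxOf_le_of_notMem_inv (hJ : Consistent k J) (ρ : AdmOrder k J) (hXc : X.card = k + 1)
    (hX : X ∉ ρ.inv) {a b : Fin n} (ha : a ∈ X) (hb : b ∈ X) (hab : a < b) :
    ρ.list.idxOf (X.erase b) ≤ ρ.list.idxOf (X.erase a) := by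
  by_cases haJ : X.erase a ∈ J
  swap
  · rw [ρ.idxOf_of_notMem haJ]; exact List.idxOf_le_length
  obtain ⟨hl, hlex⟩ := inducesLex_of_notMem_inv hJ ρ hXc hX ha haJ
  exact ((inducesLex_iff ρ.nodup hXc).1 hlex a ha b hb hab (ρ.mem_list.2 haJ)
    (ρ.mem_list.2 (hl b hb a ha hab haJ))).le

/-- An alternation at $z<y<x$ makes the positions of $Y\setminus\{x,y\}$, $Y\setminus\{x,z\}$ and
$Y\setminus\{y,z\}$ weakly cyclic, hence equal. Distinct listed sets have distinct positions, so all
three are absent; then inversion means being a suffix packet, and suffix packets do not alternate.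
-/
theorem inv_consistent (hJ : Consistent k J) (ρ : AdmOrder k J) : Consistent (k + 1) ρ.inv := by
  intro Y hY
  have hc : ∀ z ∈ Y, (Y.erase z).card = k + 1 := fun z hz => by
    rw [Finset.card_erase_of_mem hz, hY]; rfl
  let e : Fin n → Fin n → ℕ := fun a b => ρ.list.idxOf ((Y.erase a).erase b)
  have hsymm : ∀ a b, e a b = e b a := fun a b => by
    simp only [e]; rw [Finset.erase_right_comm]
  have hin : ∀ x ∈ Y, Y.erase x ∈ ρ.inv → ∀ a ∈ Y, ∀ b ∈ Y, a ≠ x → b ≠ x → a < b →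
      e x a ≤ e x b := fun x _ hi a ha b hb hax hbx hab =>
    ρ.idxOf_le_of_mem_inv hi (Finset.mem_erase.2 ⟨hax, ha⟩) (Finset.mem_erase.2 ⟨hbx, hb⟩) hab
  have hout : ∀ x ∈ Y, Y.erase x ∉ ρ.inv → ∀ a ∈ Y, ∀ b ∈ Y, a ≠ x → b ≠ x → a < b →
      e x b ≤ e x a := fun x hx hi a ha b hb hax hbx hab =>
    idxOf_le_of_notMem_inv hJ ρ (hc x hx) hi (Finset.mem_erase.2 ⟨hax, ha⟩)
      (Finset.mem_erase.2 ⟨hbx, hb⟩) hab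
  have habsent : ∀ x ∈ Y, ∀ a ∈ Y, ∀ b ∈ Y, a ≠ x → b ≠ x → a ≠ b → e x a = e x b →
      (Y.erase x).erase a ∉ J := by
    intro x _ a ha b hb hax hbx hab heq haJ
    have := (List.idxOf_inj (ρ.mem_list.2 haJ)).1 heq
    have hb' : b ∈ (Y.erase x).erase a :=
      Finset.mem_erase.2 ⟨hab.symm, Finset.mem_erase.2 ⟨hbx, hb⟩⟩
    rw [this] at hb'
    exact Finset.notMem_erase _ _ hb'
  have hmem : ∀ x ∈ Y, ∀ a ∈ Y, a ≠ x → (Y.erase x).erase a ∉ J →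
      (Y.erase x ∈ ρ.inv ↔ Y.erase x ∈ suf k J) := by
    intro x _ a ha hax haJ
    rw [mem_inv]
    exact or_iff_right fun h => haJ ((mem_full.1 h.1).2 a (Finset.mem_erase.2 ⟨hax, ha⟩))
  have hfinish : ∀ x ∈ Y, ∀ y ∈ Y, ∀ z ∈ Y, z < y → y < x → e x y = e x z → e x y = e y z →
      (Y.erase x ∈ ρ.inv ↔ Y.erase x ∈ suf k J) ∧ (Y.erase y ∈ ρ.inv ↔ Y.erase y ∈ suf k J) ∧
      (Y.erase z ∈ ρ.inv ↔ Y.erase z ∈ suf k J) := by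
    intro x hx y hy z hz hzy hyx h1 h2
    have hzx := hzy.trans hyx
    refine ⟨hmem x hx y hy hyx.ne (habsent x hx y hy z hz hyx.ne hzx.ne hzy.ne' h1),
      hmem y hy x hx hyx.ne' (habsent y hy x hx z hz hyx.ne' hzy.ne hzx.ne' ?_),
      hmem z hz x hx hzx.ne' (habsent z hz x hx y hy hzx.ne' hzy.ne' hyx.ne' ?_)⟩
    · rw [hsymm y x, h2]
    · rw [hsymm z x, hsymm z y, ← h1, h2]
  refine lower_or_upper_of_no_alternation ?_ ?_
  · rintro x hx y hy z hz hzy hyx ⟨h1, h2, h3⟩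
    have hzx := hzy.trans hyx
    have i1 := hin x hx h1 z hz y hy hzx.ne hyx.ne hzy
    have i2 := hout y hy h2 z hz x hx hzy.ne hyx.ne' hzx
    have i3 := hin z hz h3 y hy x hx hzy.ne' hzx.ne' hyx
    rw [hsymm y x] at i2
    rw [hsymm z x, hsymm z y] at i3
    obtain ⟨e1, e2, e3⟩ := hfinish x hx y hy z hz hzy hyx (by omega) (by omega)
    rw [e1] at h1
    rw [e2] at h2
    rw [e3] at h3
    exact (hJ.suf_no_alternation hY hx hy hz hzy hyx).1 ⟨h1, h2, h3⟩
  · rintro x hx y hy z hz hzy hyx ⟨h1, h2, h3⟩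
    have hzx := hzy.trans hyx
    have i1 := hout x hx h1 z hz y hy hzx.ne hyx.ne hzy
    have i2 := hin y hy h2 z hz x hx hzy.ne hyx.ne' hzx
    have i3 := hout z hz h3 y hy x hx hzy.ne' hzx.ne' hyx
    rw [hsymm y x] at i2
    rw [hsymm z x, hsymm z y] at i3
    obtain ⟨e1, e2, e3⟩ := hfinish x hx y hy z hz hzy hyx (by omega) (by omega)
    rw [e1] at h1
    rw [e2] at h2
    rw [e3] at h3
    exact (hJ.suf_no_alternation hY hx hy hz hzy hyx).2 ⟨h1, h2, h3⟩

end AdmOrder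

/-- `A` precedes `B` in every order on `k`-sets that is antilexicographic on the packets of the
elements of `V` and lexicographic on all others. -/
def Forced (k : ℕ) (V : Family n) (A B : Finset (Fin n)) : Prop :=
  ∃ X : Finset (Fin n), X.card = k + 1 ∧ ∃ a ∈ X, ∃ b ∈ X, a < b ∧
    ((X ∈ V ∧ A = X.erase a ∧ B = X.erase b) ∨ (X ∉ V ∧ A = X.erase b ∧ B = X.erase a))

theorem Ranks.lt_of_forced {V : Family n} {f : Finset (Fin n) → ℕ} (hf : Ranks k V f)
    {A B : Finset (Fin n)} (h : Forced k V A B) : f A < f B := by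
  obtain ⟨X, hX, a, ha, b, hb, hab, ⟨hV, rfl, rfl⟩ | ⟨hV, rfl, rfl⟩⟩ := h
  · exact (hf X hX a ha b hb hab).1 hV
  · exact (hf X hX a ha b hb hab).2 hV

theorem inducesAnti_of_forced {V : Family n} {l : List (Finset (Fin n))} (hl : l.Nodup)
    (hV : l.Pairwise fun A B => ¬ Forced k V B A) (hX : X.card = k + 1) (hXV : X ∈ V) :
    InducesAnti k l X := by
  rw [inducesAnti_iff hl hX]
  intro a ha b hb hab hal hbl
  rw [pairwise_iff_idxOf hl] at hV
  by_contra hlt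
  rcases (not_lt.1 hlt).eq_or_lt with heq | hlt
  · have := (List.idxOf_inj hbl).1 heq
    exact Finset.notMem_erase a X (this ▸ Finset.mem_erase.2 ⟨hab.ne, ha⟩)
  · exact hV _ hbl _ hal hlt ⟨X, hX, a, ha, b, hb, hab, Or.inl ⟨hXV, rfl, rfl⟩⟩

theorem inducesLex_of_forced {V : Family n} {l : List (Finset (Fin n))} (hl : l.Nodup)
    (hV : l.Pairwise fun A B => ¬ Forced k V B A) (hX : X.card = k + 1) (hXV : X ∉ V) :
    InducesLex k l X := by
  rw [inducesLex_iff hl hX]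
  intro a ha b hb hab hal hbl
  rw [pairwise_iff_idxOf hl] at hV
  by_contra hlt
  rcases (not_lt.1 hlt).eq_or_lt with heq | hlt
  · have := (List.idxOf_inj hal).1 heq
    exact Finset.notMem_erase a X (this ▸ Finset.mem_erase.2 ⟨hab.ne, ha⟩)
  · exact hV _ hal _ hbl hlt ⟨X, hX, a, ha, b, hb, hab, Or.inr ⟨hXV, rfl, rfl⟩⟩

theorem notMem_suf_of_mem_pre (hX : X ∈ pre k J) : X ∉ suf k J := by
  intro hX'
  obtain ⟨-, hl, ⟨a, ha, haJ⟩, ⟨b, hb, hbJ⟩⟩ := mem_pre.1 hX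
  have hu := (mem_suf.1 hX').2.1
  rcases lt_trichotomy a b with h | rfl | h
  · exact hbJ (hl b hb a ha h haJ)
  · exact hbJ haJ
  · exact hbJ (hu a ha b hb h haJ)

/-- A list respecting `V` is an admissible order with inversion set `V`. -/
theorem exists_admOrder (hk : 1 ≤ k) {V : Family n} {l : List (Finset (Fin n))} (hl : l.Nodup)
    (hlJ : l.toFinset = J) (hV : l.Pairwise fun A B => ¬ Forced k V B A) (hs : suf k J ⊆ V)
    (hV' : V ⊆ suf k J ∪ full k J) : ∃ ρ : AdmOrder k J, ρ.list = l ∧ ρ.inv = V := by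
  have hfull : ∀ X ∈ full k J, InducesLex k l X ∨ InducesAnti k l X := fun X hX => by
    by_cases hXV : X ∈ V
    · exact Or.inr (inducesAnti_of_forced hl hV (mem_full.1 hX).1 hXV)
    · exact Or.inl (inducesLex_of_forced hl hV (mem_full.1 hX).1 hXV)
  refine ⟨⟨l, hl, hlJ, fun X hX => inducesAnti_of_forced hl hV (mem_suf.1 hX).1 (hs hX),
    fun X hX => inducesLex_of_forced hl hV (mem_pre.1 hX).1 fun hXV => ?_, hfull⟩, rfl, ?_⟩
  -- A proper prefix packet is neither a proper suffix nor full, so it lies outside `V` and is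
  -- listed lexicographically.
  · rcases Finset.mem_union.1 (hV' hXV) with h | h
    · exact notMem_suf_of_mem_pre hX h
    · obtain ⟨-, -, -, ⟨a, ha, haJ⟩⟩ := mem_pre.1 hX
      exact haJ ((mem_full.1 h).2 a ha)
  · ext X
    rw [AdmOrder.mem_inv]
    constructor
    · rintro (⟨hXf, hXa⟩ | h)
      · by_contra hXV
        obtain ⟨hX, hXJ⟩ := mem_full.1 hXf
        have hXl := inducesLex_of_forced hl hV hX hXV
        -- Two different faces are needed for the two orders to be incompatible; for `k = 0` they
        -- would coincide.
        obtain ⟨a, ha, b, hb, hab⟩ := Finset.one_lt_card.1 (by omega : 1 < X.card)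
        have hmem : ∀ c ∈ X, X.erase c ∈ l := fun c hc => by
          rw [← List.mem_toFinset, hlJ]; exact hXJ c hc
        rw [inducesLex_iff hl hX] at hXl
        change InducesAnti k l X at hXa
        rw [inducesAnti_iff hl hX] at hXa
        rcases lt_or_gt_of_ne hab with h | h
        · exact lt_asymm (hXl a ha b hb h (hmem a ha) (hmem b hb))
            (hXa a ha b hb h (hmem a ha) (hmem b hb))
        · exact lt_asymm (hXl b hb a ha h (hmem b hb) (hmem a ha))
            (hXa b hb a ha h (hmem b hb) (hmem a ha))
      · exact hs h
    · intro hXV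
      rcases Finset.mem_union.1 (hV' hXV) with h | h
      · exact Or.inr h
      · exact Or.inl ⟨h, inducesAnti_of_forced hl hV (mem_full.1 h).1 hXV⟩

end Orders

/-! ### A class is determined by its inversion set. -/

section Uniqueness

variable {n k : ℕ} {J : Family n}

/-- Interchange of two neighbouring independent elements of a list. -/
def ListSwap {α : Type*} (indep : α → α → Prop) (l l' : List α) : Prop :=
  ∃ (u v : List α) (A B : α), indep A B ∧ l = u ++ A :: B :: v ∧ l' = u ++ B :: A :: v

theorem ListSwap.append_left {α : Type*} {indep : α → α → Prop} {l l' : List α}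
    (h : ListSwap indep l l') (w : List α) : ListSwap indep (w ++ l) (w ++ l') := by
  obtain ⟨u, v, A, B, hAB, rfl, rfl⟩ := h
  exact ⟨w ++ u, v, A, B, hAB, by simp, by simp⟩

theorem reflTransGen_listSwap_move {α : Type*} {indep : α → α → Prop} (a : α) (s : List α) :
    ∀ p : List α, (∀ b ∈ p, indep b a) →
      Relation.ReflTransGen (ListSwap indep) (p ++ a :: s) (a :: (p ++ s)) := by
  intro p
  induction p with
  | nil => exact fun _ => Relation.ReflTransGen.refl
  | cons b p ih =>
    intro h
    have h1 := ih fun c hc => h c (List.mem_cons_of_mem _ hc)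
    have h2 : Relation.ReflTransGen (ListSwap indep) (b :: (p ++ a :: s)) (b :: a :: (p ++ s)) :=
      h1.lift (fun l => [b] ++ l) fun _ _ h => h.append_left [b]
    exact h2.tail ⟨[], p ++ s, b, a, h b List.mem_cons_self, rfl, rfl⟩

/-- Two enumerations of the same set in which dependent elements appear in the same order are
connected by interchanges of neighbouring independent elements. -/
theorem reflTransGen_listSwap {α : Type*} [DecidableEq α] {indep : α → α → Prop} :
    ∀ l' l : List α, l.Nodup → l.Perm l' →
      (∀ A ∈ l, ∀ B ∈ l, l.idxOf A < l.idxOf B → l'.idxOf B < l'.idxOf A → indep A B) →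
      Relation.ReflTransGen (ListSwap indep) l l' := by
  intro l'
  induction l' with
  | nil =>
    intro l _ hp _
    rw [hp.eq_nil]
  | cons a t ih =>
    intro l hl hp h
    obtain ⟨p, s, rfl⟩ := List.append_of_mem (hp.mem_iff.2 List.mem_cons_self)
    have hmid := List.nodup_middle.1 hl
    have hap : a ∉ p ++ s := (List.nodup_cons.1 hmid).1
    have hnps := (List.nodup_cons.1 hmid).2
    have hpt : (p ++ s).Perm t := (List.perm_middle.symm.trans hp).cons_inv
    have hat : a ∉ t := fun h' => hap (hpt.mem_iff.2 h')
    -- The entries before `a` in `l` come after it in `l'`, so they are independent of `a`, and `a`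
    -- can be moved to the front.
    refine (reflTransGen_listSwap_move a s p fun b hb => ?_).trans ?_
    · have hba : b ≠ a := fun h' => hap (h' ▸ List.mem_append_left _ hb)
      refine h b (by simp [hb]) a (by simp) ?_ ?_
      · have h1 : a ∉ p := fun h' => hap (List.mem_append_left _ h')
        rw [List.idxOf_append_of_mem hb, List.idxOf_append_of_notMem h1]
        have := List.idxOf_lt_length_iff.2 hb
        omega
      · rw [List.idxOf_cons_self, List.idxOf_cons_ne _ hba.symm]
        exact Nat.succ_pos _
    · have hmono : ∀ A ∈ p ++ s, ∀ B ∈ p ++ s, (p ++ s).idxOf A < (p ++ s).idxOf B →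
          (p ++ a :: s).idxOf A < (p ++ a :: s).idxOf B := by
        intro A hA B hB hlt
        have hsub : (p ++ s).Sublist (p ++ a :: s) :=
          List.Sublist.append_left (List.sublist_cons_self _ _) _
        have h1 : (p ++ a :: s).Pairwise fun A B =>
            (p ++ a :: s).idxOf A < (p ++ a :: s).idxOf B :=
          (pairwise_iff_idxOf hl).2 fun _ _ _ _ h => h
        exact (pairwise_iff_idxOf hnps).1 (h1.sublist hsub) A hA B hB hlt
      have hrec := ih (p ++ s) hnps hpt fun A hA B hB hAB hBA => by
        refine h A ?_ B ?_ (hmono A hA B hB hAB) ?_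
        · simp only [List.mem_append, List.mem_cons] at hA ⊢; tauto
        · simp only [List.mem_append, List.mem_cons] at hB ⊢; tauto
        · rw [List.idxOf_cons_ne _ (fun h' : a = A => hap (h' ▸ hA)),
            List.idxOf_cons_ne _ (fun h' : a = B => hap (h' ▸ hB))]
          exact Nat.succ_lt_succ hBA
      exact hrec.lift (fun l => [a] ++ l) fun _ _ h => h.append_left [a]

namespace AdmOrder

/-- No `k`-packet contains both sets. -/
def Indep (k : ℕ) (A B : Finset (Fin n)) : Prop :=
  ¬ ∃ X ∈ C n (k + 1), A ∈ packet k X ∧ B ∈ packet k X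

theorem exists_of_listSwap (ρ : AdmOrder k J) {l : List (Finset (Fin n))}
    (h : ListSwap (Indep k) ρ.list l) : ∃ σ : AdmOrder k J, σ.list = l ∧ ElemEquiv ρ σ := by
  obtain ⟨u, v, A, B, hAB, h1, h2⟩ := h
  have hperm : ρ.list.Perm l := by
    rw [h1, h2]
    exact (List.Perm.swap B A v).append_left u
  have hl : ∀ X ∈ C n (k + 1),
      (ρ.list.filter fun A => A ∈ packet k X) = l.filter fun A => A ∈ packet k X := by
    intro X hXC
    rw [h1, h2]
    by_cases hA : A ∈ packet k X
    · have hB : B ∉ packet k X := fun hB => hAB ⟨X, hXC, hA, hB⟩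
      simp [hA, hB]
    · simp [List.filter_cons, hA]
  have hC : ∀ X, X.card = k + 1 → X ∈ C n (k + 1) := fun X hX => mem_C.2 hX
  refine ⟨⟨l, hperm.nodup_iff.1 ρ.nodup, ?_, ?_, ?_, ?_⟩, rfl, ⟨u, v, A, B, hAB, h1, h2⟩⟩
  · rw [← ρ.toFinset_eq]
    exact (List.toFinset_eq_of_perm _ _ hperm).symm
  · intro X hX
    unfold InducesAnti
    rw [← hl X (hC X (mem_suf.1 hX).1)]
    exact ρ.anti_of_suf X hX
  · intro X hX
    unfold InducesLex
    rw [← hl X (hC X (mem_pre.1 hX).1)]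
    exact ρ.lex_of_pre X hX
  · intro X hX
    unfold InducesAnti InducesLex
    rw [← hl X (hC X (mem_full.1 hX).1)]
    exact ρ.lex_or_anti_of_full X hX

theorem ext_list {ρ σ : AdmOrder k J} (h : ρ.list = σ.list) : ρ = σ := by
  cases ρ; cases σ; cases h; rfl

theorem eqvGen_of_listSwap (σ : AdmOrder k J) {l : List (Finset (Fin n))}
    (h : Relation.ReflTransGen (ListSwap (Indep k)) l σ.list) :
    ∀ ρ : AdmOrder k J, ρ.list = l → Relation.EqvGen ElemEquiv ρ σ := by
  induction h using Relation.ReflTransGen.head_induction_on with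
  | refl => intro ρ h; rw [ext_list h]; exact Relation.EqvGen.refl _
  | head h _ ih =>
    intro ρ hρ
    subst hρ
    obtain ⟨τ, hτ, hρτ⟩ := ρ.exists_of_listSwap h
    exact Relation.EqvGen.trans _ _ _ (Relation.EqvGen.rel _ _ hρτ) (ih τ hτ)

/-- Admissible orders with the same inversion set are equivalent. -/
theorem eqvGen_of_inv_eq (hJ : Consistent k J) {ρ σ : AdmOrder k J} (h : ρ.inv = σ.inv) :
    Relation.EqvGen ElemEquiv ρ σ := by
  refine eqvGen_of_listSwap σ (reflTransGen_listSwap σ.list ρ.list ρ.nodup ?_ ?_) ρ rfl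
  · rw [List.perm_ext_iff_of_nodup ρ.nodup σ.nodup]
    intro A
    rw [ρ.mem_list, σ.mem_list]
  · rintro A hA B hB hlt hlt' ⟨X, hXC, hAX, hBX⟩
    have hX := mem_C.1 hXC
    obtain ⟨a, ha, rfl⟩ := (mem_packet hX).1 hAX
    obtain ⟨b, hb, rfl⟩ := (mem_packet hX).1 hBX
    rcases lt_trichotomy a b with hab | rfl | hab
    -- A pair in a common packet is ordered by whether that packet is inverted, which is the same
    -- for both orders.
    · by_cases hi : X ∈ ρ.inv
      · exact absurd (σ.idxOf_le_of_mem_inv (h ▸ hi) ha hb hab) (not_le.2 hlt')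
      · exact absurd (ρ.idxOf_le_of_notMem_inv hJ hX hi ha hb hab) (not_le.2 hlt)
    · exact lt_irrefl _ hlt
    · by_cases hi : X ∈ ρ.inv
      · exact absurd (ρ.idxOf_le_of_mem_inv hi hb ha hab) (not_le.2 hlt)
      · exact absurd (σ.idxOf_le_of_notMem_inv hJ hX (h ▸ hi) hb ha hab) (not_le.2 hlt')

end AdmOrder

theorem Classes.eq_of_inv_eq (hJ : Consistent k J) {r s : Classes k J} (h : r.inv = s.inv) :
    r = s := by
  induction r using Quotient.inductionOn with
  | h ρ =>
  induction s using Quotient.inductionOn with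
  | h σ => exact Quotient.sound (AdmOrder.eqvGen_of_inv_eq hJ h)

end Uniqueness

/-! ### Inversion sets of the Bruhat order, packet flips and the greatest element. -/

section Maximum

variable {n k : ℕ} {J : Family n}

theorem exists_sorted {α : Type*} [DecidableEq α] (S : Finset α) (f : α → ℕ) :
    ∃ l : List α, l.Nodup ∧ l.toFinset = S ∧ l.Pairwise fun A B => f A ≤ f B := by
  refine ⟨S.toList.insertionSort fun A B => f A ≤ f B, ?_, ?_, ?_⟩
  · exact (List.perm_insertionSort _ _).nodup_iff.2 S.nodup_toList
  · rw [List.toFinset_eq_of_perm _ _ (List.perm_insertionSort _ _), Finset.toList_toFinset]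
  · have : Std.Total fun A B : α => f A ≤ f B := ⟨fun A B => le_total _ _⟩
    have : IsTrans α fun A B => f A ≤ f B := ⟨fun _ _ _ => le_trans⟩
    exact List.pairwise_insertionSort _ _

/-- Families of `(k+1)`-sets that can be inversion sets of elements of the Bruhat order. -/
structure BruhatInversionSet (J : Family n) (k : ℕ) (V : Family n) : Prop where
  consistent : Consistent (k + 1) V
  of_inL : ∀ X : Finset (Fin n), X.card = k + 1 → InL J X → X ∈ V
  inM : ∀ X ∈ V, InM J X
  card_eq : ∀ X ∈ V, X.card = k + 1

namespace BruhatInversionSet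

theorem suf_subset (hJ : Realizable 2 J) (hk : 2 ≤ k) {V : Family n}
    (hV : BruhatInversionSet J k V) : suf k (M J k) ⊆ V := fun X hX => by
  have hc := (mem_suf.1 hX).1
  exact hV.of_inL X hc ((mem_suf_M_iff hJ hk hc).1 hX)

theorem mem_full_of_isClique (hJ : Realizable 2 J) (hk : 2 ≤ k) {X : Finset (Fin n)}
    (hX : X.card = k + 1) (hcl : IsClique J X) : X ∈ full k (M J k) := by
  refine mem_full.2 ⟨hX, fun a ha => (mem_M_iff hJ hk ?_).2 ?_⟩
  · rw [Finset.card_erase_of_mem ha, hX]; rfl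
  · exact Or.inl (hcl.mono (Finset.erase_subset _ _))

theorem subset_suf_union_full (hJ : Realizable 2 J) (hk : 2 ≤ k) {V : Family n}
    (hV : BruhatInversionSet J k V) : V ⊆ suf k (M J k) ∪ full k (M J k) := fun X hX => by
  have hc := hV.card_eq X hX
  by_cases hcl : IsClique J X
  · exact Finset.mem_union_right _ (mem_full_of_isClique hJ hk hc hcl)
  · exact Finset.mem_union_left _ ((mem_suf_M_iff hJ hk hc).2 ((hV.inM X hX).inL hcl))

/-- The elements of `L^k` are closed under forced predecessors. -/
theorem mem_L_of_forced (hJ : Realizable 2 J) (hk : 2 ≤ k) {V : Family n}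
    (hV : BruhatInversionSet J k V) {A B : Finset (Fin n)} (hAB : Forced k V A B)
    (hB : B ∈ L J k) : A ∈ L J k := by
  obtain ⟨X, hX, a, ha, b, hb, hab, hcase⟩ := hAB
  have hc : ∀ z ∈ X, (X.erase z).card = k := fun z hz => by
    rw [Finset.card_erase_of_mem hz, hX]; rfl
  have hXcl : ¬ IsClique J X := by
    intro hcl
    rcases hcase with ⟨-, -, rfl⟩ | ⟨-, -, rfl⟩
    · exact ((mem_L_iff hJ hk (hc b hb)).1 hB).1 (hcl.mono (Finset.erase_subset _ _))
    · exact ((mem_L_iff hJ hk (hc a ha)).1 hB).1 (hcl.mono (Finset.erase_subset _ _))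
  obtain ⟨q, m, h⟩ := exists_pivot hJ hXcl
  have hlt := h.lt
  -- On non-cliques `V` is prescribed, so the parity determines the direction of the forced
  -- relation.
  have hXV : X ∈ V ↔ Even (topClique J X).card := by
    rw [← h.inL_iff]
    exact ⟨fun h' => (hV.inM X h').inL hXcl, hV.of_inL X hX⟩
  rcases hcase with ⟨hXV', rfl, rfl⟩ | ⟨hXV', rfl, rfl⟩
  · have he := hXV.1 hXV'
    rw [mem_L_iff hJ hk (hc b hb)] at hB
    rw [mem_L_iff hJ hk (hc a ha)]
    have hbm : b ≤ m := not_lt.1 fun h' =>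
      Nat.not_odd_iff_even.2 he ((h.inL_erase_of_gt hb h').1 hB)
    have haq : a ≤ q := (h.le_or_ge a ha).resolve_right (not_le.2 (hab.trans_le hbm))
    rcases haq.eq_or_lt with rfl | haq
    · obtain rfl := le_antisymm hbm ((h.le_or_ge b hb).resolve_left (not_le.2 hab))
      exact (h.twin_of_even hJ he).1 hB
    · exact (h.inL_erase_of_lt haq).2 he
  · have he : ¬ Even (topClique J X).card := fun h' => hXV' (hXV.2 h')
    have ho := Nat.not_even_iff_odd.1 he
    rw [mem_L_iff hJ hk (hc a ha)] at hB
    rw [mem_L_iff hJ hk (hc b hb)]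
    have hqa : q ≤ a := not_lt.1 fun h' => he ((h.inL_erase_of_lt h').1 hB)
    have hmb : m ≤ b := (h.le_or_ge b hb).resolve_left (not_le.2 (hqa.trans_lt hab))
    rcases hmb.eq_or_lt with rfl | hmb
    · obtain rfl := le_antisymm ((h.le_or_ge a ha).resolve_right (not_le.2 hab)) hqa
      exact (h.twin_of_odd hJ ho).1 hB
    · exact (h.inL_erase_of_gt hb hmb).2 ho

end BruhatInversionSet

theorem L_subset_M (hJ : Realizable 2 J) (hk : 2 ≤ k) : L J k ⊆ M J k := by
  intro X hX
  have hc : X.card = k := by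
    obtain ⟨i, rfl⟩ := Nat.exists_eq_add_of_le' hk
    cases i with
    | zero => exact absurd hX (Finset.notMem_empty _)
    | succ i => exact (mem_suf.1 (show X ∈ suf (i + 2) (M J (i + 2)) from hX)).1
  exact (mem_M_iff hJ hk hc).2 ((mem_L_iff hJ hk hc).1 hX).inM

theorem bruhatInversionSet_M (hJ : Realizable 2 J) (hk : 2 ≤ k) :
    BruhatInversionSet J k (M J (k + 1)) where
  consistent := M_consistent hJ (by omega)
  of_inL X hX h := (mem_M_iff hJ (by omega) hX).2 h.inM
  inM X hX := (mem_M_iff hJ (by omega) (mem_C.1 (M_subset_C hJ _ hX))).1 hX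
  card_eq X hX := mem_C.1 (M_subset_C hJ _ hX)

/-- The inversion set of an admissible order which places `L^k` first. -/
theorem bruhatInversionSet_inv (hJ : Realizable 2 J) (hk : 2 ≤ k) (ρ : AdmOrder k (M J k))
    (hρ : ρ.PlacesFirst (L J k)) : BruhatInversionSet J k ρ.inv where
  consistent := ρ.inv_consistent (M_consistent hJ hk)
  of_inL X hX h := AdmOrder.mem_inv.2 (Or.inr ((mem_suf_M_iff hJ hk hX).2 h))
  card_eq X hX := by
    rcases AdmOrder.mem_inv.1 hX with h | h
    · exact (mem_full.1 h.1).1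
    · exact (mem_suf.1 h).1
  inM X hX := by
    rcases AdmOrder.mem_inv.1 hX with ⟨hXf, hXa⟩ | h
    swap
    · exact ((mem_suf_M_iff hJ hk (mem_suf.1 h).1).1 h).inM
    obtain ⟨hXc, hXM⟩ := mem_full.1 hXf
    have hc : ∀ z ∈ X, (X.erase z).card = k := fun z hz => by
      rw [Finset.card_erase_of_mem hz, hXc]; rfl
    by_contra hXn
    have hcl : ¬ IsClique J X := fun h => hXn (Or.inl h)
    obtain ⟨q, m, h⟩ := exists_pivot hJ hcl
    have ho : Odd (topClique J X).card := by
      rw [← Nat.not_even_iff_odd]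
      exact fun h' => hXn (Or.inr h')
    have hinM : ∀ z ∈ X, InM J (X.erase z) := fun z hz => (mem_M_iff hJ hk (hc z hz)).1 (hXM z hz)
    -- A full packet with odd top clique has nothing before `q`, so `X.erase q` is a clique outside
    -- $L^k$. A face beyond the pivot lies in $L^k$, and an antilexicographic packet would list it
    -- after `X.erase q`, although $L^k$ comes first.
    have hqmin : ∀ z ∈ X, q ≤ z := fun z hz => not_lt.1 fun h' =>
      Nat.not_even_iff_odd.2 ho ((h.inM_erase_of_lt h').1 (hinM z hz))
    obtain ⟨d, hd, hmd⟩ : ∃ d ∈ X, m < d := by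
      by_contra hcon
      push Not at hcon
      have : X ⊆ {q, m} := fun z hz => by
        rw [Finset.mem_insert, Finset.mem_singleton]
        exact (h.le_or_ge z hz).imp (fun h' => le_antisymm h' (hqmin z hz))
          (fun h' => le_antisymm (hcon z hz) h')
      have := (Finset.card_le_card this).trans Finset.card_le_two
      omega
    have hdL : X.erase d ∈ L J k :=
      (mem_L_iff hJ hk (hc d hd)).2 ((h.inL_erase_of_gt hd hmd).2 ho)
    have hqL : X.erase q ∉ L J k := by
      rw [mem_L_iff hJ hk (hc q h.left_mem)]
      refine fun hL => hL.1 fun a ha b hb hab => ?_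
      rw [Finset.mem_erase] at ha hb
      exact h.clique a ha.2 b hb.2 ((h.le_or_ge a ha.2).resolve_left fun h' =>
        ha.1 (le_antisymm h' (hqmin a ha.2))) hab
    have hlt := (inducesAnti_iff ρ.nodup hXc).1 hXa q h.left_mem d hd (h.lt.trans hmd)
      (ρ.mem_list.2 (hXM q h.left_mem)) (ρ.mem_list.2 (hXM d hd))
    obtain ⟨u, v, huv, hu⟩ := hρ
    have hdu : X.erase d ∈ u := by rw [← List.mem_toFinset, hu]; exact hdL
    have hqu : X.erase q ∉ u := by rw [← List.mem_toFinset, hu]; exact hqL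
    rw [huv, List.idxOf_append_of_mem hdu, List.idxOf_append_of_notMem hqu] at hlt
    have := List.idxOf_lt_length_iff.2 hdu
    omega

/-- Every possible inversion set is attained. -/
theorem exists_admOrder_of_bruhatInversionSet (hJ : Realizable 2 J) (hk : 2 ≤ k) {V : Family n}
    (hV : BruhatInversionSet J k V) :
    ∃ ρ : AdmOrder k (M J k), ρ.PlacesFirst (L J k) ∧ ρ.inv = V := by
  obtain ⟨f, hf⟩ := hV.consistent.exists_ranks
  obtain ⟨u, hu, huL, huf⟩ := exists_sorted (L J k) f
  obtain ⟨v, hv, hvM, hvf⟩ := exists_sorted (M J k \ L J k) f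
  have hmu : ∀ A, A ∈ u ↔ A ∈ L J k := fun A => by rw [← List.mem_toFinset, huL]
  have hmv : ∀ A, A ∈ v ↔ A ∈ M J k ∧ A ∉ L J k := fun A => by
    rw [← List.mem_toFinset, hvM, Finset.mem_sdiff]
  obtain ⟨ρ, hρ, hinv⟩ := exists_admOrder (J := M J k) (l := u ++ v) (by omega : 1 ≤ k) (V := V)
    (by
      rw [List.nodup_append]
      refine ⟨hu, hv, ?_⟩
      rintro A hA B hB rfl
      exact ((hmv A).1 hB).2 ((hmu A).1 hA))
    (by rw [List.toFinset_append, huL, hvM, Finset.union_sdiff_of_subset (L_subset_M hJ hk)])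
    (by
      rw [List.pairwise_append]
      refine ⟨huf.imp fun h h' => absurd (hf.lt_of_forced h') (not_lt.2 h),
        hvf.imp fun h h' => absurd (hf.lt_of_forced h') (not_lt.2 h), ?_⟩
      intro A hA B hB h
      exact ((hmv B).1 hB).2 (hV.mem_L_of_forced hJ hk h ((hmu A).1 hA)))
    (hV.suf_subset hJ hk) (hV.subset_suf_union_full hJ hk)
  exact ⟨ρ, ⟨u, v, hρ, huL⟩, hinv⟩

/-- Adding `X` to `V` changes only the precedences between faces of `X`, so everything outside the
flipped block remains valid for both inversion sets. -/
theorem forced_iff_of_notMem_packet {V : Family n} {X A B : Finset (Fin n)}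
    (hX : X.card = k + 1) (hAB : ¬ (A ∈ packet k X ∧ B ∈ packet k X)) :
    Forced k (insert X V) A B ↔ Forced k V A B := by
  have hne : ∀ Y, Y.card = k + 1 → ∀ a ∈ Y, ∀ b ∈ Y,
      (A = Y.erase a ∧ B = Y.erase b) ∨ (A = Y.erase b ∧ B = Y.erase a) → Y ≠ X := by
    rintro Y - a ha b hb h rfl
    rcases h with ⟨rfl, rfl⟩ | ⟨rfl, rfl⟩
    · exact hAB ⟨erase_mem_packet hX ha, erase_mem_packet hX hb⟩
    · exact hAB ⟨erase_mem_packet hX hb, erase_mem_packet hX ha⟩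
  constructor
  · rintro ⟨Y, hY, a, ha, b, hb, hab, h⟩
    have hYX := hne Y hY a ha b hb (h.imp And.right And.right)
    rw [Finset.mem_insert, or_iff_right hYX] at h
    exact ⟨Y, hY, a, ha, b, hb, hab, h⟩
  · rintro ⟨Y, hY, a, ha, b, hb, hab, h⟩
    have hYX := hne Y hY a ha b hb (h.imp And.right And.right)
    rw [← or_iff_right (b := Y ∈ V) hYX, ← Finset.mem_insert] at h
    exact ⟨Y, hY, a, ha, b, hb, hab, h⟩

/-- If `V` and `V ∪ {X}` are possible inversion sets, they are connected by a packet flip. -/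
theorem exists_flip (hJ : Realizable 2 J) (hk : 2 ≤ k) {V : Family n} {X : Finset (Fin n)}
    (hV : BruhatInversionSet J k V) (hV' : BruhatInversionSet J k (insert X V))
    (hXcl : IsClique J X) (hXV : X ∉ V) :
    ∃ ρ σ : AdmOrder k (M J k), ρ.PlacesFirst (L J k) ∧ σ.PlacesFirst (L J k) ∧
      ρ.inv = V ∧ σ.inv = insert X V ∧ AdmOrder.IsFlip X ρ σ := by
  classical
  obtain ⟨f, hf⟩ := hV.consistent.exists_ranks
  obtain ⟨g, hg⟩ := hV'.consistent.exists_ranks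
  have hX := hV'.card_eq X (Finset.mem_insert_self _ _)
  have hrev : ∀ A ∈ packet k X, ∀ B ∈ packet k X, g A < g B → f B < f A := by
    intro A hA B hB hAB
    obtain ⟨a, ha, rfl⟩ := (mem_packet hX).1 hA
    obtain ⟨b, hb, rfl⟩ := (mem_packet hX).1 hB
    rcases lt_trichotomy a b with h | rfl | h
    · exact (hf X hX a ha b hb h).2 hXV
    · exact absurd hAB (lt_irrefl _)
    · exact absurd ((hg X hX b hb a ha h).1 (Finset.mem_insert_self _ _)) hAB.not_gt
  have hXf := BruhatInversionSet.mem_full_of_isClique hJ hk hX hXcl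
  have hPM : ∀ A ∈ packet k X, A ∈ M J k := by
    intro A hA
    obtain ⟨a, ha, rfl⟩ := (mem_packet hX).1 hA
    exact (mem_full.1 hXf).2 a ha
  have hPL : ∀ A ∈ packet k X, A ∉ L J k := by
    intro A hA
    obtain ⟨a, ha, rfl⟩ := (mem_packet hX).1 hA
    rw [mem_L_iff hJ hk (by rw [Finset.card_erase_of_mem ha, hX]; rfl)]
    exact fun h => h.1 (hXcl.mono (Finset.erase_subset _ _))
  -- Sets lying below some packet element in both rankings go before the block. No packet element
  -- can be forced before such a set: it would lie below another packet element in both rankings,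
  -- while `f` and `g` order the packet oppositely. This makes the packet a contiguous block.
  let below : Finset (Fin n) → Prop := fun B => ∃ A ∈ packet k X, f B < f A ∧ g B < g A
  obtain ⟨w, hw, hwS, hwf⟩ := exists_sorted (L J k) f
  obtain ⟨d, hd, hdS, hdf⟩ := exists_sorted
    ((M J k).filter fun B => B ∉ L J k ∧ B ∉ packet k X ∧ below B) f
  obtain ⟨c, hc, hcS, hcf⟩ := exists_sorted (packet k X) f
  obtain ⟨v, hv, hvS, hvf⟩ := exists_sorted
    ((M J k).filter fun B => B ∉ L J k ∧ B ∉ packet k X ∧ ¬ below B) f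
  have hmw : ∀ A, A ∈ w ↔ A ∈ L J k := fun A => by rw [← List.mem_toFinset, hwS]
  have hmd : ∀ A, A ∈ d ↔ A ∈ M J k ∧ A ∉ L J k ∧ A ∉ packet k X ∧ below A := fun A => by
    rw [← List.mem_toFinset, hdS, Finset.mem_filter]
  have hmc : ∀ A, A ∈ c ↔ A ∈ packet k X := fun A => by rw [← List.mem_toFinset, hcS]
  have hmv : ∀ A, A ∈ v ↔ A ∈ M J k ∧ A ∉ L J k ∧ A ∉ packet k X ∧ ¬ below A := fun A => by
    rw [← List.mem_toFinset, hvS, Finset.mem_filter]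
  have hforced : ∀ A B, ¬ (A ∈ packet k X ∧ B ∈ packet k X) → Forced k V B A →
      f B < f A ∧ g B < g A := fun A B hAB h =>
    ⟨hf.lt_of_forced h, hg.lt_of_forced ((forced_iff_of_notMem_packet hX
      fun h' => hAB h'.symm).2 h)⟩
  have hnotL : ∀ A B, A ∈ L J k → B ∉ L J k → ¬ Forced k V B A := fun A B hA hB h =>
    hB (hV.mem_L_of_forced hJ hk h hA)
  have hdc : ∀ A ∈ d, ∀ B ∈ c, ¬ Forced k V B A := by
    intro A hA B hB h
    obtain ⟨-, -, hAP, A₀, hA₀, hfA, hgA⟩ := (hmd A).1 hA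
    obtain ⟨h1, h2⟩ := hforced A B (fun h' => hAP h'.1) h
    exact lt_asymm (h1.trans hfA) (hrev B ((hmc B).1 hB) A₀ hA₀ (h2.trans hgA))
  have hdv : ∀ A ∈ d, ∀ B ∈ v, ¬ Forced k V B A := by
    intro A hA B hB h
    obtain ⟨-, -, hAP, A₀, hA₀, hfA, hgA⟩ := (hmd A).1 hA
    obtain ⟨h1, h2⟩ := hforced A B (fun h' => hAP h'.1) h
    exact ((hmv B).1 hB).2.2.2 ⟨A₀, hA₀, h1.trans hfA, h2.trans hgA⟩
  have hcv : ∀ A ∈ c, ∀ B ∈ v, ¬ Forced k V B A := by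
    intro A hA B hB h
    have hB' := (hmv B).1 hB
    exact hB'.2.2.2 ⟨A, (hmc A).1 hA, hforced A B (fun h' => hB'.2.2.1 h'.2) h⟩
  have hsorted : ∀ l : List (Finset (Fin n)), l.Pairwise (fun A B => f A ≤ f B) →
      l.Pairwise fun A B => ¬ Forced k V B A := fun l hl =>
    hl.imp fun h h' => absurd (hf.lt_of_forced h') (not_lt.2 h)
  have hu : (w ++ d).Pairwise fun A B => ¬ Forced k V B A :=
    List.pairwise_append.2 ⟨hsorted w hwf, hsorted d hdf, fun A hA B hB =>
      hnotL A B ((hmw A).1 hA) ((hmd B).1 hB).2.1⟩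
  have huc : ∀ A ∈ w ++ d, ∀ B ∈ c, ¬ Forced k V B A := by
    intro A hA B hB
    rcases List.mem_append.1 hA with hA | hA
    · exact hnotL A B ((hmw A).1 hA) (hPL B ((hmc B).1 hB))
    · exact hdc A hA B hB
  have huv : ∀ A ∈ w ++ d, ∀ B ∈ v, ¬ Forced k V B A := by
    intro A hA B hB
    rcases List.mem_append.1 hA with hA | hA
    · exact hnotL A B ((hmw A).1 hA) ((hmv B).1 hB).2.1
    · exact hdv A hA B hB
  have huP : ∀ A ∈ w ++ d, A ∉ packet k X := by
    intro A hA hAP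
    rcases List.mem_append.1 hA with hA | hA
    · exact hPL A hAP ((hmw A).1 hA)
    · exact ((hmd A).1 hA).2.2.1 hAP
  have hvP : ∀ A ∈ v, A ∉ packet k X := fun A hA => ((hmv A).1 hA).2.2.1
  have hnodup : (w ++ d ++ c ++ v).Nodup := by
    refine List.nodup_append.2 ⟨List.nodup_append.2 ⟨List.nodup_append.2 ⟨hw, hd, ?_⟩, hc, ?_⟩,
      hv, ?_⟩
    · rintro A hA B hB rfl
      exact ((hmd A).1 hB).2.1 ((hmw A).1 hA)
    · rintro A hA B hB rfl
      exact huP A hA ((hmc A).1 hB)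
    · rintro A hA B hB rfl
      have hB' := (hmv A).1 hB
      rcases List.mem_append.1 hA with hA | hA
      · rcases List.mem_append.1 hA with hA | hA
        · exact hB'.2.1 ((hmw A).1 hA)
        · exact hB'.2.2.2 ((hmd A).1 hA).2.2.2
      · exact hB'.2.2.1 ((hmc A).1 hA)
  have htoFinset : (w ++ d ++ c ++ v).toFinset = M J k := by
    ext A
    simp only [List.mem_toFinset, List.mem_append, hmw, hmd, hmc, hmv]
    constructor
    · rintro (((h | h) | h) | h)
      exacts [L_subset_M hJ hk h, h.1, hPM A h, h.1]
    · intro h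
      by_cases hL : A ∈ L J k
      · exact Or.inl (Or.inl (Or.inl hL))
      by_cases hP : A ∈ packet k X
      · exact Or.inl (Or.inr hP)
      by_cases hb : below A
      · exact Or.inl (Or.inl (Or.inr ⟨h, hL, hP, hb⟩))
      · exact Or.inr ⟨h, hL, hP, hb⟩
  have hperm : (w ++ d ++ c ++ v).Perm (w ++ d ++ c.reverse ++ v) :=
    ((List.reverse_perm c).symm.append_left (w ++ d)).append_right v
  have hsame : ∀ A B, ¬ (A ∈ packet k X ∧ B ∈ packet k X) → ¬ Forced k V B A →
      ¬ Forced k (insert X V) B A := fun A B hAB h => by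
    rwa [forced_iff_of_notMem_packet hX fun h' => hAB h'.symm]
  have hsame' : ∀ l : List (Finset (Fin n)), (∀ A ∈ l, A ∉ packet k X) →
      l.Pairwise (fun A B => ¬ Forced k V B A) →
      l.Pairwise (fun A B => ¬ Forced k (insert X V) B A) := fun l hl hp =>
    hp.imp_of_mem fun hA _ h => hsame _ _ (fun h' => hl _ hA h'.1) h
  obtain ⟨ρ, hρ, hρi⟩ := exists_admOrder (by omega : 1 ≤ k) hnodup htoFinset
    (List.pairwise_append.2 ⟨List.pairwise_append.2 ⟨hu, hsorted c hcf, huc⟩, hsorted v hvf,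
      fun A hA B hB => by
        rcases List.mem_append.1 hA with hA | hA
        · exact huv A hA B hB
        · exact hcv A hA B hB⟩)
    (hV.suf_subset hJ hk) (hV.subset_suf_union_full hJ hk)
  obtain ⟨σ, hσ, hσi⟩ := exists_admOrder (by omega : 1 ≤ k) (hperm.nodup_iff.1 hnodup)
    ((List.toFinset_eq_of_perm _ _ hperm).symm.trans htoFinset)
    (List.pairwise_append.2 ⟨List.pairwise_append.2 ⟨hsame' _ huP hu,
      List.pairwise_reverse.2 (hcf.imp_of_mem fun {A B} hA hB h h' =>
        absurd (hrev A ((hmc A).1 hA) B ((hmc B).1 hB) (hg.lt_of_forced h')) (not_lt.2 h)),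
      fun A hA B hB => hsame A B (fun h' => huP A hA h'.1) (huc A hA B (List.mem_reverse.1 hB))⟩,
      hsame' _ hvP (hsorted v hvf), fun A hA B hB => by
        refine hsame A B (fun h' => hvP B hB h'.2) ?_
        rcases List.mem_append.1 hA with hA | hA
        · exact huv A hA B hB
        · exact hcv A (List.mem_reverse.1 hA) B hB⟩)
    (hV'.suf_subset hJ hk) (hV'.subset_suf_union_full hJ hk)
  refine ⟨ρ, σ, ⟨w, d ++ c ++ v, ?_, hwS⟩, ⟨w, d ++ c.reverse ++ v, ?_, hwS⟩, hρi, hσi, hXf,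
    w ++ d, c, v, hcS, hρ, hσ⟩
  · rw [hρ]; simp only [List.append_assoc]
  · rw [hσ]; simp only [List.append_assoc]

/-- The element with inversion set `M^{k+1}` dominates every element of the Bruhat order. -/
theorem le_of_inv_eq_M (hJ : Realizable 2 J) (hk : 2 ≤ k) {r : Classes k (M J k)}
    (hr : r.inv = M J (k + 1)) (N : ℕ) : ∀ s ∈ BruhatOrder J k,
      (M J (k + 1) \ s.inv).card ≤ N → s ≤ r := by
  have hcons := M_consistent hJ hk
  induction N with
  | zero =>
    rintro s ⟨ρ, hρ, rfl⟩ hcard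
    have hV := bruhatInversionSet_inv hJ hk ρ hρ
    have hsub : M J (k + 1) ⊆ ρ.inv := by
      rw [← Finset.sdiff_eq_empty_iff_subset]
      exact Finset.card_eq_zero.1 (Nat.le_zero.1 hcard)
    refine le_of_eq (Classes.eq_of_inv_eq hcons ?_)
    rw [hr]
    refine Finset.Subset.antisymm (fun X hX => ?_) hsub
    exact (mem_M_iff hJ (by omega) (hV.card_eq X hX)).2 (hV.inM X hX)
  | succ N ih =>
    rintro s ⟨τ, hτ, rfl⟩ hcard
    change (M J (k + 1) \ τ.inv).card ≤ N + 1 at hcard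
    have hV := bruhatInversionSet_inv hJ hk τ hτ
    by_cases hsub : M J (k + 1) ⊆ τ.inv
    · refine ih _ ⟨τ, hτ, rfl⟩ ?_
      change (M J (k + 1) \ τ.inv).card ≤ N
      rw [Finset.sdiff_eq_empty_iff_subset.2 hsub]
      exact Nat.zero_le _
    obtain ⟨X, hXM, hXV⟩ := Finset.not_subset.1 hsub
    have hXc := mem_C.1 (M_subset_C hJ _ hXM)
    obtain ⟨Y, hY, hYcl, hYV, hYcons⟩ := exists_consistent_insert hJ hk hV.consistent hV.of_inL
      (fun X _ hX => hV.inM X hX) ⟨X, hXc, (mem_M_iff hJ (by omega) hXc).1 hXM, hXV⟩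
    have hV' : BruhatInversionSet J k (insert Y τ.inv) :=
      { consistent := hYcons
        of_inL := fun X hX h => Finset.mem_insert_of_mem (hV.of_inL X hX h)
        inM := fun X hX => by
          rcases Finset.mem_insert.1 hX with rfl | hX
          · exact Or.inl hYcl
          · exact hV.inM X hX
        card_eq := fun X hX => by
          rcases Finset.mem_insert.1 hX with rfl | hX
          · exact hY
          · exact hV.card_eq X hX }
    obtain ⟨ρ, σ, -, hσL, hρ, hσ, hflip⟩ := exists_flip hJ hk hV hV' hYcl hYV
    -- The order `τ` itself need not have the packet as a block; the equivalent order `ρ` with the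
    -- same inversion set does.
    have hstep : Classes.FlipUp (Classes.mk τ) (Classes.mk σ) :=
      ⟨Y, ρ, σ, Classes.eq_of_inv_eq hcons hρ, rfl, hYV, hflip⟩
    have hle : Classes.mk σ ≤ r := by
      refine ih _ ⟨σ, hσL, rfl⟩ ?_
      change (M J (k + 1) \ σ.inv).card ≤ N
      rw [hσ, Finset.sdiff_insert]
      have : Y ∈ M J (k + 1) \ τ.inv :=
        Finset.mem_sdiff.2 ⟨(mem_M_iff hJ (by omega) hY).2 (Or.inl hYcl), hYV⟩
      rw [Finset.card_erase_of_mem this]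
      omega
    exact le_trans (Relation.ReflTransGen.single hstep : Classes.mk τ ≤ Classes.mk σ) hle

theorem exists_greatest (hJ : Realizable 2 J) (hk : 2 ≤ k) : ∃ r : BruhatOrder J k,
    (∀ r' : BruhatOrder J k, r'.1.inv = M J (k + 1) ↔ r' = r) ∧
    (∀ r' : BruhatOrder J k, r' ≤ r) ∧
    (∀ r' : BruhatOrder J k, IsMax r' ↔ r' = r) := by
  obtain ⟨ρ, hρ, hinv⟩ :=
    exists_admOrder_of_bruhatInversionSet hJ hk (bruhatInversionSet_M hJ hk)
  have hle : ∀ r' : BruhatOrder J k, r' ≤ ⟨Classes.mk ρ, ρ, hρ, rfl⟩ := fun r' =>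
    le_of_inv_eq_M hJ hk (r := Classes.mk ρ) hinv _ r'.1 r'.2 le_rfl
  refine ⟨⟨Classes.mk ρ, ρ, hρ, rfl⟩, fun r' => ⟨fun h => ?_, fun h => ?_⟩, hle,
    fun r' => ⟨fun h => (h.eq_of_le (hle r')), fun h => ?_⟩⟩
  · exact Subtype.ext (Classes.eq_of_inv_eq (M_consistent hJ hk) (h.trans hinv.symm))
  · rw [h]; exact hinv
  · rw [h]; exact fun s _ => hle s

end Maximum

end HigherBruhat

theorem mainTheorem7 {n : ℕ} (J : HigherBruhat.Family n) (hJ : HigherBruhat.Realizable 2 J) :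
    (∀ (i : ℕ) (K : HigherBruhat.Family n), 2 ≤ i → HigherBruhat.Realizable i K →
      HigherBruhat.L J i ⊆ K → K ⊆ HigherBruhat.M J i →
      HigherBruhat.Realizable (i + 1)
        (HigherBruhat.suf i K ∪ HigherBruhat.suf i (HigherBruhat.M J i))) ∧
    (∀ i : ℕ, 3 ≤ i →
      ∃ r : HigherBruhat.BruhatOrder J (i - 1),
        (∀ r' : HigherBruhat.BruhatOrder J (i - 1),
          r'.1.inv = HigherBruhat.M J i ↔ r' = r) ∧
        (∀ r' : HigherBruhat.BruhatOrder J (i - 1), r' ≤ r) ∧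
        (∀ r' : HigherBruhat.BruhatOrder J (i - 1), IsMax r' ↔ r' = r)) := by
  refine ⟨fun i K hi hK hL hM => HigherBruhat.realizable_suf_union_suf hJ hi hK hL hM,
    fun i hi => ?_⟩
  obtain ⟨k, rfl⟩ : ∃ k, i = k + 1 := ⟨i - 1, by omega⟩
  exact HigherBruhat.exists_greatest hJ (by omega)
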